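/- Base stations form a homogeneous Poisson point process of density $\lambda>0$ in the plane. The typical user is at the origin and is served by the nearest base station $\mathrm{BS}_0$; $d_i=\sqrt{\|\mathrm{BS}_i\|^2+\Delta h^2}$ is the distance between antennas, with height difference $\Delta h>0$. The path loss is multi-slope: $l_N(x)=K_nx^{-\alpha_n}$ for $R_n\le x<R_{n+1}$, $0\le n\le N-1$, with $N\ge 1$, $0=R_0<R_1<\dots<R_N=\infty$, $0\le\alpha_0\le\dots\le\alpha_{N-1}$, $\alpha_{N-1}>2$, $K_n=\prod_{i=1}^nR_i^{\alpha_i-\alpha_{i-1}}$. Let $P>0$ be the transmit power, $\tau>0$ the decoding threshold, $N_a\ge1$ the number of antennas per base station, and let $$\widetilde{\mathrm{CP}}(\lambda)=\mathbb P\Big\{\frac{P\,\tilde g_0\,l_N(d_0)}{\sum_{i\ge1}P\,g_i\,l_N(d_i)}>\tau\Big\}$$ be the approximate coverage probability, in which the power gains are independent of each other and of the positions, the interfering gains $g_i$ $(i\ge1)$ are $\chi^2_2$-distributed (exponential with mean $2$), and the serving gain $\tilde g_0$, exactly $\chi^2_{2N_a}$-distributed, is approximated by an exponential variable with the same mean $2N_a$.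 Put $\tau^\dagger=\tau/N_a$, $\omega_1(x,y)={}_2F_1(1,1-\tfrac2y;2-\tfrac2y;-x)$ and $\delta(x,y)=\frac{2x\,\omega_1(x,y)}{y-2}$. Theorem. For every $\varepsilon>0$, a necessary condition for the coverage requirement $\widetilde{\mathrm{CP}}(\lambda)>\varepsilon$ to hold for some density $\lambda>0$ is $$\frac{2\tau^\dagger\,\omega_1(\tau^\dagger,\alpha_{N-1})}{\alpha_{N-1}-2}<\varepsilon^{-1}-1 .$$ Moreover, the supremum of $\widetilde{\mathrm{CP}}(\lambda)$ over $\lambda>0$ is its limit as $\lambda\to0$, and it equals $\dfrac{1}{1+\delta(\tau^\dagger,\alpha_{N-1})}$. -/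

import Mathlib

open MeasureTheory ProbabilityTheory Filter Topology

noncomputable section

/-- The real Gauss hypergeometric function `₂F₁(a, b; c; z)` for `0 < b < c` and `z < 1`, through
Euler's integral (which is the analytic continuation of the hypergeometric series to `z ≤ -1`). -/
def gaussHypergeometric (a b c z : ℝ) : ℝ :=
  Real.Gamma c / (Real.Gamma b * Real.Gamma (c - b)) *
    ∫ t in (0 : ℝ)..1, t ^ (b - 1) * (1 - t) ^ (c - b - 1) * (1 - z * t) ^ (-a)

/-- `ω₁(x, y) = ₂F₁(1, 1 - 2/y; 2 - 2/y; -x)`. -/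
def omega1 (x y : ℝ) : ℝ := gaussHypergeometric 1 (1 - 2 / y) (2 - 2 / y) (-x)

/-- `δ(x, y) = 2 x ω₁(x, y) / (y - 2)`. -/
def delta (x y : ℝ) : ℝ := 2 * x * omega1 x y / (y - 2)

/-- Parameters of a multi-slope path-loss model: `N ≥ 1` slopes, corner distances
`0 = R 0 < R 1 < ⋯ < R (N - 1)` (with the convention that the `N`-th corner distance is `∞`), and
exponents `0 ≤ α 0 ≤ ⋯ ≤ α (N - 1)` with `2 < α (N - 1)`. The values of `R` and `α` at indices
`≥ N` play no role. -/
structure MultiSlope where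
  N : ℕ
  N_pos : 0 < N
  R : ℕ → ℝ
  R_zero : R 0 = 0
  R_lt : ∀ n, n + 1 < N → R n < R (n + 1)
  α : ℕ → ℝ
  α_zero : 0 ≤ α 0
  α_le : ∀ n, n + 1 < N → α n ≤ α (n + 1)
  α_last : 2 < α (N - 1)

namespace MultiSlope

/-- `K 0 = 1` and `K n = ∏_{i=1}^n R_i ^ (α_i - α_{i-1})`. -/
def K (S : MultiSlope) (n : ℕ) : ℝ :=
  ∏ i ∈ Finset.Icc 1 n, S.R i ^ (S.α i - S.α (i - 1))

open Classical in
/-- The path loss at distance `x ≥ 0`: it is `K n * x ^ (-α n)` for the unique `n < N` with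
`R n ≤ x < R (n + 1)`, where there is no upper bound on `x` for the last slope `n = N - 1`. -/
def pathLoss (S : MultiSlope) (x : ℝ) : ℝ :=
  ∑ n ∈ Finset.range S.N,
    if S.R n ≤ x ∧ (n + 1 < S.N → x < S.R (n + 1)) then S.K n * x ^ (-S.α n) else 0

end MultiSlope

/-- The plane with its Euclidean norm. -/
abbrev Plane : Type := EuclideanSpace ℝ (Fin 2)

/-- The number of points of the random configuration `{X i}` that lie in `B`. -/
def pointCount {Ω : Type*} (X : ℕ → Ω → Plane) (B : Set Plane) (ω : Ω) : ℕ∞ :=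
  {i : ℕ | X i ω ∈ B}.encard

/-- The random points `X 0, X 1, …` enumerate a homogeneous Poisson point process of intensity
`lam` in the plane: the number of points in a Borel set of finite area is Poisson distributed with
mean `lam` times the area, and the numbers of points in finitely many pairwise disjoint such sets
are independent. -/
structure IsHomogeneousPPP {Ω : Type*} [MeasurableSpace Ω] (μ : Measure Ω) (lam : ℝ)
    (X : ℕ → Ω → Plane) : Prop where
  measurable : ∀ i, Measurable (X i)
  count_law : ∀ B : Set Plane, MeasurableSet B → volume B ≠ ⊤ → ∀ k : ℕ,
    μ {ω | pointCount X B ω = k} =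
      ENNReal.ofReal (Real.exp (-(lam * volume.real B)) * (lam * volume.real B) ^ k / k.factorial)
  count_indep : ∀ (m : ℕ) (B : Fin m → Set Plane), (∀ j, MeasurableSet (B j)) →
    (∀ j, volume (B j) ≠ ⊤) → Pairwise (fun j k => Disjoint (B j) (B k)) →
    iIndepFun (fun j ω => pointCount X (B j) ω) μ

/-- Downlink network seen by the typical user, who is located at the origin. The base stations
`X 0, X 1, …` form a homogeneous Poisson point process of density `lam`, and `X 0` is the serving
one, that is, the nearest to the user. The channel power gains `gain i` are independent of each
other and of the positions. An interfering link has a chi-square gain with two degrees of freedom,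
that is, an exponential gain of mean `2`. The gain of the serving link of a base station with `Na`
antennas is approximated by an exponential gain of mean `2 * Na` (instead of a chi-square one with
`2 * Na` degrees of freedom, which has the same mean). -/
structure IsApproxDownlink {Ω : Type*} [MeasurableSpace Ω] (μ : Measure Ω) (lam : ℝ) (Na : ℕ)
    (X : ℕ → Ω → Plane) (gain : ℕ → Ω → ℝ) : Prop where
  ppp : IsHomogeneousPPP μ lam X
  nearest : ∀ᵐ ω ∂μ, ∀ i, ‖X 0 ω‖ ≤ ‖X i ω‖
  gain_serving : HasLaw (gain 0) (expMeasure (1 / (2 * Na))) μ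
  gain_interfering : ∀ i, HasLaw (gain (i + 1)) (expMeasure (1 / 2)) μ
  gain_indep : iIndepFun gain μ
  indep : IndepFun (fun ω i => X i ω) (fun ω i => gain i ω) μ

/-- The distance between the antenna of the user at the origin and that of a base station at `x`,
when their heights differ by `Δh`. -/
def antennaDist (Δh : ℝ) (x : Plane) : ℝ := Real.sqrt (‖x‖ ^ 2 + Δh ^ 2)

/-- The total intercell interference power at the user. -/
def interference {Ω : Type*} (S : MultiSlope) (P Δh : ℝ) (X : ℕ → Ω → Plane) (gain : ℕ → Ω → ℝ)
    (ω : Ω) : ENNReal :=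
  ∑' i : ℕ, ENNReal.ofReal
    (P * gain (i + 1) ω * S.pathLoss (antennaDist Δh (X (i + 1) ω)))

/-- The signal-to-interference ratio at the user. -/
def sir {Ω : Type*} (S : MultiSlope) (P Δh : ℝ) (X : ℕ → Ω → Plane) (gain : ℕ → Ω → ℝ)
    (ω : Ω) : ENNReal :=
  ENNReal.ofReal (P * gain 0 ω * S.pathLoss (antennaDist Δh (X 0 ω))) /
    interference S P Δh X gain ω

/-- The coverage probability `μ {SIR > τ}` of a threshold `τ`. -/
def coverageProb {Ω : Type*} [MeasurableSpace Ω] (μ : Measure Ω) (S : MultiSlope) (P Δh τ : ℝ)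
    (X : ℕ → Ω → Plane) (gain : ℕ → Ω → ℝ) : ℝ :=
  μ.real {ω | ENNReal.ofReal τ < sir S P Δh X gain ω}

end

/-! Conditionally on the positions, the exponential serving gain turns coverage into a Laplace
transform of the interference, and the exponential interfering gains turn that into a product of
factors `1 / (1 + τ† ρ i)`, where `ρ i` is the path loss of the `i`-th interferer divided by that of
the server (`IsApproxDownlink.measure_coverage`).

Write `α` for the last exponent. The path loss times `x ^ α` is nondecreasing, and adding `Δh ^ 2`
to both squared distances only brings their ratio closer to one. Hence `ρ i` is at least its value
in a single-slope model of exponent `α` without height difference. In that model only the ratios of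
squared distances matter, so by scale invariance the answer does not depend on the density; it is `1
/ (1 + δ)` (`lintegral_expNeg_ratioSum`, `toReal_tailIntegral_slopeTest`). This bounds the coverage
for every density.

Conversely, if the server is far away, all stations lie on the last slope and the height is
negligible, so `ρ i` exceeds the single-slope value by a factor close to one. For small density the
server is far with probability close to one, so the bound is attained in the limit.

The single-slope value is found without conditioning on the nearest point. Its squared distance is
sorted into geometric cells; on each cell the expectation is squeezed by differences of Laplace
functionals whose test functions are infinite near the origin, and the cell ratio then tends to one.
-/

/-! ### Exponentials of extended nonnegative reals -/

/-- The exponential `exp (-x)` of an extended nonnegative real, with `exp (-∞) = 0`. -/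
noncomputable def expNeg (x : ENNReal) : ENNReal := EReal.exp (-(x : EReal))

lemma expNeg_zero : expNeg 0 = 1 := by simp [expNeg]

lemma expNeg_top : expNeg ⊤ = 0 := by simp [expNeg]

lemma expNeg_ofReal {r : ℝ} (hr : 0 ≤ r) :
    expNeg (ENNReal.ofReal r) = ENNReal.ofReal (Real.exp (-r)) := by
  rw [expNeg, EReal.coe_ennreal_ofReal, max_eq_left hr, ← EReal.coe_neg, EReal.exp_coe]

lemma expNeg_antitone : Antitone expNeg := fun x y h => by
  unfold expNeg
  exact EReal.exp_monotone (EReal.neg_le_neg_iff.2 (by exact_mod_cast h))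

lemma expNeg_le_one (x : ENNReal) : expNeg x ≤ 1 := by
  rw [← expNeg_zero]
  exact expNeg_antitone (zero_le)

lemma expNeg_ne_top (x : ENNReal) : expNeg x ≠ ⊤ :=
  ((expNeg_le_one x).trans_lt ENNReal.one_lt_top).ne

lemma continuous_expNeg : Continuous expNeg := by
  unfold expNeg
  exact ENNReal.continuous_exp.comp (continuous_neg.comp continuous_coe_ennreal_ereal)

lemma measurable_expNeg : Measurable expNeg := continuous_expNeg.measurable

lemma expNeg_add (x y : ENNReal) : expNeg (x + y) = expNeg x * expNeg y := by
  induction x with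
  | top => simp [expNeg_top]
  | coe x =>
    induction y with
    | top => simp [expNeg_top]
    | coe y =>
      simp only [← ENNReal.ofReal_coe_nnreal]
      rw [← ENNReal.ofReal_add x.coe_nonneg y.coe_nonneg, expNeg_ofReal (by positivity),
        expNeg_ofReal x.coe_nonneg, expNeg_ofReal y.coe_nonneg, ← ENNReal.ofReal_mul (by positivity),
        ← Real.exp_add]
      congr 2
      ring

lemma expNeg_sum {ι : Type*} (s : Finset ι) (f : ι → ENNReal) :
    expNeg (∑ i ∈ s, f i) = ∏ i ∈ s, expNeg (f i) := by
  classical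
  induction s using Finset.induction_on with
  | empty => simp [expNeg_zero]
  | insert a s ha ih => rw [Finset.sum_insert ha, Finset.prod_insert ha, expNeg_add, ih]

lemma expNeg_mul_natCast (c : ENNReal) (n : ℕ) : expNeg (c * n) = expNeg c ^ n := by
  induction n with
  | zero => simp [expNeg_zero]
  | succ n ih => rw [Nat.cast_succ, mul_add, mul_one, expNeg_add, ih, pow_succ]

/-! ### Point counts and the Laplace functional of the Poisson process -/

/-- The number of points in `B`, as an extended nonnegative real, is a sum of indicators. -/
lemma toENNReal_pointCount {Ω : Type*} (X : ℕ → Ω → Plane) (B : Set Plane) (ω : Ω) :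
    ((pointCount X B ω : ℕ∞) : ENNReal) = ∑' i, B.indicator (fun _ => (1 : ENNReal)) (X i ω) := by
  rw [pointCount, ← ENNReal.tsum_set_one, tsum_subtype {i | X i ω ∈ B} (fun _ => (1 : ENNReal))]
  rfl

lemma measurable_pointCount {Ω : Type*} [MeasurableSpace Ω] {X : ℕ → Ω → Plane}
    (hX : ∀ i, Measurable (X i)) {B : Set Plane} (hB : MeasurableSet B) :
    Measurable (pointCount X B) := by
  have h : Measurable fun ω => ((pointCount X B ω : ℕ∞) : ENNReal) := by
    simp_rw [toENNReal_pointCount]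
    exact Measurable.tsum fun i => (measurable_const.indicator hB).comp (hX i)
  refine measurable_to_countable' fun n => ?_
  have : pointCount X B ⁻¹' {n} =
      (fun ω => ((pointCount X B ω : ℕ∞) : ENNReal)) ⁻¹' {(n : ENNReal)} := by
    ext ω
    simp
  rw [this]
  exact h (measurableSet_singleton _)

namespace IsHomogeneousPPP

variable {Ω : Type*} [MeasurableSpace Ω] {μ : Measure Ω} [IsProbabilityMeasure μ] {lam : ℝ}
  {X : ℕ → Ω → Plane}

/-- This is the Poisson generating function `E z ^ N = exp (-m (1 - z))` at `z = exp (-c)`. The case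
`c = ⊤` is the void probability. -/
lemma lintegral_expNeg_pointCount (h : IsHomogeneousPPP μ lam X) (hlam : 0 ≤ lam)
    {B : Set Plane} (hB : MeasurableSet B) (hB' : volume B ≠ ⊤) (c : ENNReal) :
    ∫⁻ ω, expNeg (c * (pointCount X B ω : ℕ∞)) ∂μ =
      expNeg (ENNReal.ofReal lam * (volume B * (1 - expNeg c))) := by
  have hN := measurable_pointCount h.measurable hB
  set m := lam * volume.real B with hm
  have hm0 : 0 ≤ m := mul_nonneg hlam measureReal_nonneg
  have hs : ∀ x : ℝ, 0 ≤ x → ∑' k : ℕ, ENNReal.ofReal (x ^ k) *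
      ENNReal.ofReal (Real.exp (-m) * m ^ k / k.factorial) =
        ENNReal.ofReal (Real.exp (-(m * (1 - x)))) := by
    intro x hx
    have := (NormedSpace.expSeries_div_hasSum_exp (m * x)).mul_left (Real.exp (-m))
    rw [← Real.exp_eq_exp_ℝ, ← Real.exp_add] at this
    have h2 : HasSum (fun k : ℕ => x ^ k * (Real.exp (-m) * m ^ k / k.factorial))
        (Real.exp (-(m * (1 - x)))) := by
      rw [show -(m * (1 - x)) = -m + m * x by ring]
      refine this.congr_fun fun k => ?_
      rw [mul_pow]
      ring
    rw [← h2.tsum_eq, ENNReal.ofReal_tsum_of_nonneg (fun k => by positivity) h2.summable]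
    exact tsum_congr fun k => (ENNReal.ofReal_mul (by positivity)).symm
  -- The count law prescribes only the finite values; their probabilities already add up to one.
  have htop : μ {ω | pointCount X B ω = ⊤} = 0 := by
    have h1 : (∑' k : ℕ, μ {ω | pointCount X B ω = k}) = 1 := by
      simp_rw [h.count_law B hB hB']
      have := hs 1 zero_le_one
      simpa using this
    have h3 := measure_iUnion (μ := μ) (f := fun k : ℕ => {ω | pointCount X B ω = k})
      (fun i j hij => Set.disjoint_left.2 fun ω h1 h2 => hij (by
        simp only [Set.mem_ofPred_eq] at h1 h2
        exact_mod_cast h1.symm.trans h2)) fun k => hN (measurableSet_singleton _)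
    rw [h1] at h3
    have h4 := (prob_compl_eq_zero_iff
      (MeasurableSet.iUnion fun k : ℕ => hN (measurableSet_singleton (k : ℕ∞)))).2 h3
    refine measure_mono_null (fun ω hω => ?_) h4
    simp only [Set.mem_compl_iff, Set.mem_iUnion, Set.mem_preimage, Set.mem_singleton_iff,
      not_exists]
    intro k hk
    exact ENat.natCast_ne_top k (hk.symm.trans hω)
  have hmap : ∫⁻ ω, expNeg (c * (pointCount X B ω : ℕ∞)) ∂μ =
      ∑' n : ℕ∞, expNeg (c * n) * μ {ω | pointCount X B ω = n} := by
    rw [← lintegral_map (f := fun n : ℕ∞ => expNeg (c * n)) (measurable_of_countable _) hN,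
      lintegral_countable']
    refine tsum_congr fun n => ?_
    rw [Measure.map_apply hN (measurableSet_singleton _)]
    rfl
  have hsum : ∑' n : ℕ∞, expNeg (c * n) * μ {ω | pointCount X B ω = n} =
      ∑' n : ℕ, expNeg (c * n) * μ {ω | pointCount X B ω = n} := by
    have hinj : Function.Injective (fun n : ℕ => (n : ℕ∞)) := Nat.cast_injective
    rw [← hinj.tsum_eq (f := fun n : ℕ∞ => expNeg (c * n) * μ {ω | pointCount X B ω = n})]
    · simp
    · intro n hn
      induction n with
      | top => simp [htop] at hn
      | coe n => exact ⟨n, rfl⟩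
  rw [hmap, hsum]
  obtain ⟨x, hx⟩ : ∃ x : ℝ, x = (expNeg c).toReal := ⟨_, rfl⟩
  have hx0 : 0 ≤ x := hx ▸ ENNReal.toReal_nonneg
  have hxc : expNeg c = ENNReal.ofReal x := by rw [hx, ENNReal.ofReal_toReal (expNeg_ne_top c)]
  have hx1 : x ≤ 1 := by
    rw [hx]
    exact ENNReal.toReal_le_of_le_ofReal zero_le_one (by simpa using expNeg_le_one c)
  simp_rw [expNeg_mul_natCast, h.count_law B hB hB', hxc, ← ENNReal.ofReal_pow hx0]
  rw [hs x hx0, ← expNeg_ofReal (mul_nonneg hm0 (by linarith)),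
    ENNReal.ofReal_mul hm0, hm, ENNReal.ofReal_mul hlam, measureReal_def,
    ENNReal.ofReal_toReal hB', ENNReal.ofReal_sub _ hx0, ENNReal.ofReal_one, mul_assoc]

/-- The sum over the points is a combination of counts in the disjoint level sets, so independence
of the counts factorises the expectation. -/
lemma laplace_simpleFunc (h : IsHomogeneousPPP μ lam X) (hlam : 0 ≤ lam)
    (s : SimpleFunc Plane ENNReal) (hs : volume (Function.support s) ≠ ⊤) :
    ∫⁻ ω, expNeg (∑' i, s (X i ω)) ∂μ =
      expNeg (ENNReal.ofReal lam * ∫⁻ x, (1 - expNeg (s x))) := by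
  classical
  -- The value zero is left out: its level set has infinite area and contributes nothing.
  set T := s.range.filter (· ≠ 0) with hT
  have hvol : ∀ c ∈ T, volume (s ⁻¹' {c}) ≠ ⊤ := by
    intro c hc
    refine ne_top_of_le_ne_top hs (measure_mono fun x hx => ?_)
    simp only [Set.mem_preimage, Set.mem_singleton_iff] at hx
    rw [Function.mem_support, hx]
    exact (Finset.mem_filter.1 hc).2
  have hdecomp : ∀ (F : ENNReal → ENNReal), F 0 = 0 → ∀ x,
      F (s x) = ∑ c ∈ T, F c * (s ⁻¹' {c}).indicator (fun _ => 1) x := by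
    intro F hF x
    have : ∀ c ∈ T, F c * (s ⁻¹' {c}).indicator (fun _ => (1 : ENNReal)) x =
        if c = s x then F c else 0 := by
      intro c _
      by_cases hc : c = s x
      · subst hc; simp
      · have : x ∉ s ⁻¹' {c} := fun h => hc (by simpa using h.symm)
        rw [Set.indicator_of_notMem this, if_neg hc, mul_zero]
    rw [Finset.sum_congr rfl this, Finset.sum_ite_eq']
    split_ifs with hx
    · rfl
    · have : s x = 0 := by
        by_contra h0
        exact hx (Finset.mem_filter.2 ⟨s.mem_range_self x, h0⟩)
      rw [this, hF]
  have hsum : ∀ ω, ∑' i, s (X i ω) = ∑ c ∈ T, c * (pointCount X (s ⁻¹' {c}) ω : ℕ∞) := by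
    intro ω
    simp_rw [toENNReal_pointCount, ← ENNReal.tsum_mul_left]
    rw [← Summable.tsum_finsetSum fun _ _ => ENNReal.summable]
    exact tsum_congr fun i => hdecomp id rfl (X i ω)
  have hint : ∫⁻ x, (1 - expNeg (s x)) = ∑ c ∈ T, volume (s ⁻¹' {c}) * (1 - expNeg c) := by
    have : ∀ x, 1 - expNeg (s x) =
        ∑ c ∈ T, (1 - expNeg c) * (s ⁻¹' {c}).indicator (fun _ => 1) x :=
      hdecomp (fun c => 1 - expNeg c) (by simp [expNeg_zero])
    simp_rw [this]
    rw [lintegral_finsetSum]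
    · refine Finset.sum_congr rfl fun c _ => ?_
      rw [lintegral_const_mul _ (measurable_const.indicator (s.measurableSet_fiber c)),
        lintegral_indicator_const (s.measurableSet_fiber c), one_mul, mul_comm]
    · exact fun c _ => (measurable_const.indicator (s.measurableSet_fiber c)).const_mul _
  simp_rw [hsum, expNeg_sum]
  rw [hint, Finset.mul_sum, expNeg_sum]
  have hind := h.count_indep T.card (fun j => s ⁻¹' {(T.equivFin.symm j : ENNReal)})
    (fun j => s.measurableSet_fiber _) (fun j => hvol _ (T.equivFin.symm j).2) (by
      intro j k hjk
      refine Set.disjoint_left.2 fun x hx hx' => hjk ?_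
      simp only [Set.mem_preimage, Set.mem_singleton_iff] at hx hx'
      exact T.equivFin.symm.injective (Subtype.ext (hx.symm.trans hx')))
  have hind' := hind.comp (fun j (n : ℕ∞) => expNeg ((T.equivFin.symm j : ENNReal) * n))
    (fun j => measurable_of_countable _)
  have hprod := lintegral_prod_eq_prod_lintegral_of_indepFun Finset.univ _ hind'
    (fun j => (measurable_of_countable _).comp
      (measurable_pointCount h.measurable (s.measurableSet_fiber _)))
  have hconv : ∀ F : ENNReal → ENNReal, ∏ j, F (T.equivFin.symm j : ENNReal) = ∏ c ∈ T, F c := by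
    intro F
    rw [← Finset.prod_coe_sort T F]
    exact Equiv.prod_comp T.equivFin.symm (fun c : T => F c)
  calc ∫⁻ ω, ∏ c ∈ T, expNeg (c * (pointCount X (s ⁻¹' {c}) ω : ℕ∞)) ∂μ
      = ∫⁻ ω, ∏ j, expNeg ((T.equivFin.symm j : ENNReal) *
          (pointCount X (s ⁻¹' {(T.equivFin.symm j : ENNReal)}) ω : ℕ∞)) ∂μ :=
        lintegral_congr fun ω =>
          (hconv fun c => expNeg (c * (pointCount X (s ⁻¹' {c}) ω : ℕ∞))).symm
    _ = ∏ j, ∫⁻ ω, expNeg ((T.equivFin.symm j : ENNReal) *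
          (pointCount X (s ⁻¹' {(T.equivFin.symm j : ENNReal)}) ω : ℕ∞)) ∂μ := hprod
    _ = ∏ c ∈ T, ∫⁻ ω, expNeg (c * (pointCount X (s ⁻¹' {c}) ω : ℕ∞)) ∂μ :=
        hconv fun c => ∫⁻ ω, expNeg (c * (pointCount X (s ⁻¹' {c}) ω : ℕ∞)) ∂μ
    _ = _ := Finset.prod_congr rfl fun c hc =>
        h.lintegral_expNeg_pointCount hlam (s.measurableSet_fiber c) (hvol c hc) c

/-- The Laplace functional of a homogeneous Poisson point process. -/
theorem laplace_functional (h : IsHomogeneousPPP μ lam X) (hlam : 0 ≤ lam)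
    {g : Plane → ENNReal} (hg : Measurable g) :
    ∫⁻ ω, expNeg (∑' i, g (X i ω)) ∂μ =
      expNeg (ENNReal.ofReal lam * ∫⁻ x, (1 - expNeg (g x))) := by
  -- Cutting to growing balls gives supports of finite area and keeps the approximation monotone.
  set s : ℕ → SimpleFunc Plane ENNReal := fun n =>
    (SimpleFunc.eapprox g n).restrict (Metric.closedBall 0 n) with hsdef
  have hsx : ∀ n x, s n x =
      (Metric.closedBall (0 : Plane) n).indicator (SimpleFunc.eapprox g n) x := fun n x => by
    rw [hsdef, SimpleFunc.restrict_apply _ measurableSet_closedBall]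
  have hmono : ∀ x, Monotone fun n => s n x := by
    intro x m n hmn
    simp only [hsx]
    refine (Set.indicator_le_indicator_of_subset
      (Metric.closedBall_subset_closedBall (Nat.cast_le.2 hmn)) (fun _ => zero_le) x).trans ?_
    exact Set.indicator_le_indicator (SimpleFunc.monotone_eapprox g hmn x)
  have hsup : ∀ x, ⨆ n, s n x = g x := by
    intro x
    rw [← SimpleFunc.iSup_eapprox_apply hg x]
    apply le_antisymm
    · exact iSup_mono fun n => by rw [hsx]; exact Set.indicator_le_self' (fun _ _ => zero_le) x
    · refine iSup_le fun n => ?_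
      obtain ⟨m, hm⟩ := exists_nat_ge ‖x‖
      refine le_iSup_of_le (max m n) ?_
      rw [hsx, Set.indicator_of_mem]
      · exact SimpleFunc.monotone_eapprox g (le_max_right m n) x
      · rw [mem_closedBall_zero_iff]
        exact hm.trans (by exact_mod_cast le_max_left m n)
  have htend : ∀ x, Tendsto (fun n => s n x) atTop (𝓝 (g x)) := fun x => by
    rw [← hsup x]
    exact tendsto_atTop_iSup (hmono x)
  have hfin : ∀ n, volume (Function.support (s n)) ≠ ⊤ := by
    intro n
    refine ne_top_of_le_ne_top (measure_closedBall_lt_top (x := (0 : Plane)) (r := n)).ne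
      (measure_mono fun x hx => ?_)
    by_contra hx'
    exact hx (by rw [hsx, Set.indicator_of_notMem hx'])
  have hleft : Tendsto (fun n => ∫⁻ ω, expNeg (∑' i, s n (X i ω)) ∂μ) atTop
      (𝓝 (∫⁻ ω, expNeg (∑' i, g (X i ω)) ∂μ)) := by
    refine tendsto_lintegral_of_dominated_convergence (fun _ => 1) (fun n => ?_)
      (fun n => Eventually.of_forall fun ω => expNeg_le_one _) (by simp) ?_
    · exact measurable_expNeg.comp
        (Measurable.tsum fun i => (s n).measurable.comp (h.measurable i))
    · refine Eventually.of_forall fun ω => (continuous_expNeg.tendsto _).comp ?_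
      have : ∑' i, g (X i ω) = ⨆ n, ∑' i, s n (X i ω) := by
        simp_rw [← lintegral_count, ← hsup]
        exact lintegral_iSup (fun n => measurable_of_countable _) fun m n hmn i => hmono _ hmn
      rw [this]
      exact tendsto_atTop_iSup fun m n hmn => ENNReal.tsum_le_tsum fun i => hmono _ hmn
  have hright : Tendsto (fun n => expNeg (ENNReal.ofReal lam * ∫⁻ x, (1 - expNeg (s n x)))) atTop
      (𝓝 (expNeg (ENNReal.ofReal lam * ∫⁻ x, (1 - expNeg (g x))))) := by
    refine (continuous_expNeg.tendsto _).comp (ENNReal.Tendsto.const_mul ?_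
      (Or.inr ENNReal.ofReal_ne_top))
    refine lintegral_tendsto_of_tendsto_of_monotone
      (fun n => (measurable_const.sub (measurable_expNeg.comp (s n).measurable)).aemeasurable)
      (Eventually.of_forall fun x m n hmn =>
        tsub_le_tsub_left (expNeg_antitone (hmono x hmn)) _) (Eventually.of_forall fun x => ?_)
    exact ENNReal.Tendsto.sub tendsto_const_nhds ((continuous_expNeg.tendsto _).comp (htend x))
      (Or.inl ENNReal.one_ne_top)
  refine tendsto_nhds_unique hleft (hright.congr fun n => ?_)
  exact (h.laplace_simpleFunc hlam (s n) (hfin n)).symm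

end IsHomogeneousPPP

/-! ### Radial test functions -/

/-- The squared distance to the origin maps the area measure to `π` times the length measure. -/
lemma map_sq_norm_volume :
    (volume : Measure Plane).map (fun x => ‖x‖ ^ 2) =
      ENNReal.ofReal Real.pi • volume.restrict (Set.Ioi (0 : ℝ)) := by
  have hm : Measurable fun x : Plane => ‖x‖ ^ 2 := by fun_prop
  have key : ∀ a : ℝ, (volume : Measure Plane).map (fun x => ‖x‖ ^ 2) (Set.Iio a) =
      ENNReal.ofReal Real.pi * ENNReal.ofReal a := by
    intro a
    rw [Measure.map_apply hm measurableSet_Iio]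
    rcases le_or_gt a 0 with ha | ha
    · have : (fun x : Plane => ‖x‖ ^ 2) ⁻¹' Set.Iio a = ∅ := by
        ext x
        simp only [Set.mem_preimage, Set.mem_Iio, Set.mem_empty_iff_false, iff_false, not_lt]
        exact ha.trans (sq_nonneg _)
      rw [this, measure_empty, ENNReal.ofReal_of_nonpos ha, mul_zero]
    · have : (fun x : Plane => ‖x‖ ^ 2) ⁻¹' Set.Iio a = Metric.ball 0 (Real.sqrt a) := by
        ext x
        simp [Real.lt_sqrt (norm_nonneg x)]
      rw [this, EuclideanSpace.volume_ball_fin_two, ← ENNReal.ofReal_pow (Real.sqrt_nonneg _),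
        Real.sq_sqrt ha.le, mul_comm]
  refine Measure.ext_of_generateFrom_of_iUnion (Set.range Set.Iio) (fun n : ℕ => Set.Iio (n : ℝ))
    (borel_eq_generateFrom_Iio ℝ ▸ BorelSpace.measurable_eq) isPiSystem_Iio ?_
    (fun n => ⟨n, rfl⟩) (fun n => ?_) ?_
  · exact Set.iUnion_eq_univ_iff.2 fun x => exists_nat_gt x
  · rw [key]
    exact (ENNReal.mul_lt_top ENNReal.ofReal_lt_top ENNReal.ofReal_lt_top).ne
  · rintro _ ⟨a, rfl⟩
    rw [key, Measure.smul_apply, Measure.restrict_apply measurableSet_Iio, smul_eq_mul,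
      Set.inter_comm, Set.Ioi_inter_Iio, Real.volume_Ioo, sub_zero]

lemma lintegral_sq_norm {F : ℝ → ENNReal} (hF : Measurable F) :
    ∫⁻ x : Plane, F (‖x‖ ^ 2) = ENNReal.ofReal Real.pi * ∫⁻ w in Set.Ioi 0, F w := by
  rw [← lintegral_map hF (by fun_prop), map_sq_norm_volume, lintegral_smul_measure, smul_eq_mul]

lemma lintegral_comp_div_Ici {F : ℝ → ENNReal} {c : ℝ} (hc : 0 < c) (b : ℝ) :
    ∫⁻ w in Set.Ici b, F (w / c) = ENNReal.ofReal c * ∫⁻ v in Set.Ici (b / c), F v := by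
  have himg : (fun v => c * v) '' Set.Ici (b / c) = Set.Ici b := by
    rw [Set.image_mul_left_Ici hc, mul_div_cancel₀ _ hc.ne']
  rw [← himg, lintegral_image_eq_lintegral_abs_deriv_mul measurableSet_Ici (f' := fun _ => c)
    (fun x _ => by simpa using ((hasDerivAt_id x).const_mul c).hasDerivWithinAt)
    (mul_right_injective₀ hc.ne').injOn]
  simp only [abs_of_pos hc]
  rw [lintegral_const_mul' _ _ ENNReal.ofReal_ne_top]
  simp_rw [mul_div_cancel_left₀ _ hc.ne']

/-- A radial test function: infinite on `w < a`, constant on `[a, b)`, and `φ (w / c)` afterwards. -/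
noncomputable def cellTest (φ : ℝ → ENNReal) (a b c : ℝ) (s : ENNReal) (w : ℝ) : ENNReal :=
  if w < a then ⊤ else if w < b then s else φ (w / c)

lemma measurable_cellTest {φ : ℝ → ENNReal} (hφ : Measurable φ) (a b c : ℝ) (s : ENNReal) :
    Measurable (cellTest φ a b c s) :=
  Measurable.ite measurableSet_Iio measurable_const
    (Measurable.ite measurableSet_Iio measurable_const (hφ.comp (measurable_id.div_const c)))

/-- The integral `∫_q^∞ (1 - exp (-φ v)) dv`. -/
noncomputable def tailIntegral (φ : ℝ → ENNReal) (q : ℝ) : ENNReal :=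
  ∫⁻ v in Set.Ici q, (1 - expNeg (φ v))

lemma lintegral_cellTest {φ : ℝ → ENNReal} {a b c : ℝ} (ha : 0 < a) (hab : a ≤ b)
    (hc : 0 < c) (s : ENNReal) :
    ∫⁻ w in Set.Ioi 0, (1 - expNeg (cellTest φ a b c s w)) =
      ENNReal.ofReal a + ENNReal.ofReal (b - a) * (1 - expNeg s) +
        ENNReal.ofReal c * tailIntegral φ (b / c) := by
  have h1 : Set.Ioi (0 : ℝ) = (Set.Ioo 0 a ∪ Set.Ico a b) ∪ Set.Ici b := by
    rw [Set.Ioo_union_Ico_eq_Ioo ha hab, Set.Ioo_union_Ici_eq_Ioi (ha.trans_le hab)]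
  rw [h1, lintegral_union measurableSet_Ici (by
      rw [Set.Ioo_union_Ico_eq_Ioo ha hab]
      exact Set.disjoint_left.2 fun x hx hx' => absurd hx.2 (not_lt.2 hx')),
    lintegral_union measurableSet_Ico
      (Set.disjoint_left.2 fun x hx hx' => absurd hx.2 (not_lt.2 hx'.1))]
  congr 1
  · congr 1
    · rw [setLIntegral_congr_fun (g := fun _ => 1) measurableSet_Ioo fun x hx => by
        simp [cellTest, hx.2, expNeg_top]]
      simp
    · rw [setLIntegral_congr_fun (g := fun _ => 1 - expNeg s) measurableSet_Ico fun x hx => by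
        simp [cellTest, hx.2, hx.1.not_gt]]
      simp [mul_comm]
  · rw [setLIntegral_congr_fun (g := fun w => 1 - expNeg (φ (w / c))) measurableSet_Ici
      fun x hx => by simp [cellTest, (Set.mem_Ici.1 hx).not_gt, (hab.trans hx).not_gt]]
    exact lintegral_comp_div_Ici (F := fun v => 1 - expNeg (φ v)) hc b

namespace IsHomogeneousPPP

variable {Ω : Type*} [MeasurableSpace Ω] {μ : Measure Ω} [IsProbabilityMeasure μ] {lam : ℝ}
  {X : ℕ → Ω → Plane}

/-- Since `exp (-∞) = 0`, the infinite value on `w < a` restricts the expectation to configurations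
with no point of squared norm below `a`. -/
lemma laplace_cellTest (h : IsHomogeneousPPP μ lam X) (hlam : 0 ≤ lam) {φ : ℝ → ENNReal}
    (hφ : Measurable φ) {a b c : ℝ} (ha : 0 < a) (hab : a ≤ b) (hc : 0 < c) (s : ENNReal)
    (hD : tailIntegral φ (b / c) ≠ ⊤) :
    ∫⁻ ω, expNeg (∑' i, cellTest φ a b c s (‖X i ω‖ ^ 2)) ∂μ =
      ENNReal.ofReal (Real.exp (-(lam * Real.pi * (a + (b - a) * (1 - (expNeg s).toReal) +
        c * (tailIntegral φ (b / c)).toReal)))) := by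
  have hs : (expNeg s).toReal ≤ 1 :=
    ENNReal.toReal_le_of_le_ofReal zero_le_one (by simpa using expNeg_le_one s)
  have hba : 0 ≤ b - a := sub_nonneg.2 hab
  rw [h.laplace_functional hlam (g := fun x => cellTest φ a b c s (‖x‖ ^ 2))
    ((measurable_cellTest hφ a b c s).comp (by fun_prop))]
  rw [lintegral_sq_norm (F := fun w => 1 - expNeg (cellTest φ a b c s w))
    (measurable_const.sub (measurable_expNeg.comp (measurable_cellTest hφ a b c s))),
    lintegral_cellTest ha hab hc]
  rw [← expNeg_ofReal]
  · congr 1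
    rw [mul_assoc, ENNReal.ofReal_mul hlam, ENNReal.ofReal_mul Real.pi_pos.le,
      ENNReal.ofReal_add, ENNReal.ofReal_add ha.le, ENNReal.ofReal_mul hba,
      ENNReal.ofReal_mul hc.le, ENNReal.ofReal_toReal hD, ENNReal.ofReal_sub _
      ENNReal.toReal_nonneg, ENNReal.ofReal_toReal (expNeg_ne_top s), ENNReal.ofReal_one]
    · exact mul_nonneg hba (by linarith)
    · exact add_nonneg ha.le (mul_nonneg hba (by linarith))
    · positivity
  · have := Real.pi_pos
    have : 0 ≤ (b - a) * (1 - (expNeg s).toReal) := mul_nonneg hba (by linarith)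
    positivity

/-- `X 0` is one of the points, so an empty disc of squared radius `a` forces `‖X 0‖ ^ 2 ≥ a`; the
void probability bounds the complement. -/
lemma measure_sq_norm_zero_lt (h : IsHomogeneousPPP μ lam X) (hlam : 0 ≤ lam) {a : ℝ}
    (ha : 0 < a) : μ {ω | ‖X 0 ω‖ ^ 2 < a} ≤
      ENNReal.ofReal (1 - Real.exp (-(lam * Real.pi * a))) := by
  have h1 := h.laplace_cellTest hlam (φ := fun _ => 0) measurable_const ha le_rfl one_pos 0 (by
    simp [tailIntegral, expNeg_zero])
  have hm : MeasurableSet {ω | ‖X 0 ω‖ ^ 2 < a} :=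
    measurableSet_lt ((h.measurable 0).norm.pow_const 2) measurable_const
  have h2 : ∫⁻ ω, expNeg (∑' i, cellTest (fun _ => 0) a a 1 0 (‖X i ω‖ ^ 2)) ∂μ ≤
      μ {ω | ‖X 0 ω‖ ^ 2 < a}ᶜ := by
    rw [← lintegral_indicator_one hm.compl]
    refine lintegral_mono fun ω => ?_
    by_cases hω : ‖X 0 ω‖ ^ 2 < a
    · have : ∑' i, cellTest (fun _ => 0) a a 1 0 (‖X i ω‖ ^ 2) = ⊤ := by
        refine top_unique (le_trans ?_ (ENNReal.le_tsum 0))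
        simp [cellTest, hω]
      simp [this, expNeg_top]
    · rw [Set.indicator_of_mem (by exact hω)]
      exact expNeg_le_one _
  rw [h1, prob_compl_eq_one_sub hm] at h2
  have h0 : tailIntegral (fun _ => 0) (a / 1) = 0 := by simp [tailIntegral, expNeg_zero]
  simp only [sub_self, zero_mul, add_zero, h0, ENNReal.toReal_zero, mul_zero] at h2
  rw [ENNReal.ofReal_sub _ (Real.exp_pos _).le, ENNReal.ofReal_one]
  have h3 := ENNReal.le_sub_of_add_le_left ENNReal.ofReal_ne_top
    ((add_le_add_left h2 _).trans_eq (tsub_add_cancel_of_le prob_le_one))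
  exact h3

lemma ae_sq_norm_zero_pos (h : IsHomogeneousPPP μ lam X) (hlam : 0 ≤ lam) :
    ∀ᵐ ω ∂μ, 0 < ‖X 0 ω‖ ^ 2 := by
  have hle : ∀ a : ℝ, 0 < a → μ {ω | ¬ 0 < ‖X 0 ω‖ ^ 2} ≤
      ENNReal.ofReal (1 - Real.exp (-(lam * Real.pi * a))) := fun a ha =>
    (measure_mono fun ω hω => (not_lt.1 hω).trans_lt ha).trans (h.measure_sq_norm_zero_lt hlam ha)
  have ht : Tendsto (fun a => ENNReal.ofReal (1 - Real.exp (-(lam * Real.pi * a)))) (𝓝[>] 0)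
      (𝓝 0) := by
    have : Continuous fun a => ENNReal.ofReal (1 - Real.exp (-(lam * Real.pi * a))) :=
      ENNReal.continuous_ofReal.comp (by fun_prop)
    exact (this.tendsto' 0 0 (by simp)).mono_left nhdsWithin_le_nhds
  exact le_antisymm (ge_of_tendsto ht (eventually_nhdsWithin_of_forall hle)) zero_le

end IsHomogeneousPPP

/-! ### Exponential laws on geometric cells, and tail integrals -/

lemma expMeasure_Ico {r a b : ℝ} (hr : 0 < r) (ha : 0 ≤ a) (hab : a ≤ b) :
    expMeasure r (Set.Ico a b) =
      ENNReal.ofReal (Real.exp (-(r * a)) - Real.exp (-(r * b))) := by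
  have := isProbabilityMeasure_expMeasure hr
  have hac : expMeasure r ≪ volume := withDensity_absolutelyContinuous _ _
  have : NullSingletonClass (expMeasure r) := ⟨fun x => hac Real.volume_singleton⟩
  have h1 : expMeasure r (Set.Ico a b) = expMeasure r (Set.Ioc a b) :=
    measure_congr Ico_ae_eq_Ioc
  rw [h1, ← measure_cdf (expMeasure r), StieltjesFunction.measure_Ioc, cdf_expMeasure_eq hr,
    cdf_expMeasure_eq hr, if_pos ha, if_pos (ha.trans hab)]
  congr 1
  ring

lemma expMeasure_Ioi_zero {r : ℝ} (hr : 0 < r) : expMeasure r (Set.Ioi 0) = 1 := by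
  have := isProbabilityMeasure_expMeasure hr
  have hm : expMeasure r (Set.Iic 0) = 0 := by
    rw [← ofReal_cdf, cdf_expMeasure_eq hr]
    simp
  rw [← Set.compl_Iic, prob_compl_eq_one_sub measurableSet_Iic, hm, tsub_zero]

lemma pairwise_disjoint_Ico_zpow_of_one_lt {q : ℝ} (hq : 1 < q) :
    Pairwise fun i j : ℤ =>
      Disjoint (Set.Ico (q ^ i) (q ^ (i + 1))) (Set.Ico (q ^ j) (q ^ (j + 1))) :=
  (zpow_right_mono₀ hq.le).pairwise_disjoint_on_Ico_succ

lemma tsum_measure_Ico_zpow (ν : Measure ℝ) {q : ℝ} (hq : 1 < q) :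
    ∑' k : ℤ, ν (Set.Ico (q ^ k) (q ^ (k + 1))) = ν (Set.Ioi 0) := by
  rw [← measure_iUnion _ fun k => measurableSet_Ico]
  · congr 1
    ext x
    simp only [Set.mem_iUnion, Set.mem_Ioi]
    exact ⟨fun ⟨k, hk⟩ => (zpow_pos (one_pos.trans hq) k).trans_le hk.1,
      fun hx => exists_mem_Ico_zpow hx hq⟩
  · exact pairwise_disjoint_Ico_zpow_of_one_lt hq

/-- Bernoulli's inequality in exponential form. -/
lemma one_add_mul_exp_sub_le {κ : ℝ} (hκ : 0 ≤ κ) (u v : ℝ) :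
    Real.exp (-(v * κ)) * (Real.exp (-u) - Real.exp (-v)) ≤
      1 / (1 + κ) * (Real.exp (-(u * (1 + κ))) - Real.exp (-(v * (1 + κ)))) := by
  have hB := one_add_mul_self_le_rpow_one_add (s := Real.exp (v - u) - 1)
    (by linarith [Real.exp_pos (v - u)]) (p := 1 + κ) (by linarith)
  rw [show 1 + (Real.exp (v - u) - 1) = Real.exp (v - u) by ring, ← Real.exp_mul] at hB
  rw [one_div, ← div_eq_inv_mul, le_div_iff₀ (by linarith)]
  have h1 : Real.exp (-u) = Real.exp (-v) * Real.exp (v - u) := by rw [← Real.exp_add]; ring_nf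
  have h2 : Real.exp (-(u * (1 + κ))) =
      Real.exp (-(v * κ)) * Real.exp (-v) * Real.exp ((v - u) * (1 + κ)) := by
    rw [← Real.exp_add, ← Real.exp_add]; ring_nf
  have h3 : Real.exp (-(v * (1 + κ))) = Real.exp (-(v * κ)) * Real.exp (-v) := by
    rw [← Real.exp_add]; ring_nf
  rw [h1, h2, h3]
  have hp : 0 < Real.exp (-(v * κ)) * Real.exp (-v) := by positivity
  nlinarith [mul_le_mul_of_nonneg_left hB hp.le]

lemma tailIntegral_le_add {φ : ℝ → ENNReal} {p q : ℝ} (hpq : p ≤ q) :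
    tailIntegral φ p ≤ ENNReal.ofReal (q - p) + tailIntegral φ q := by
  unfold tailIntegral
  rw [← Set.Ico_union_Ici_eq_Ici hpq]
  refine (lintegral_union_le _ _ _).trans (add_le_add_left ?_ _)
  calc ∫⁻ v in Set.Ico p q, (1 - expNeg (φ v)) ≤ ∫⁻ _ in Set.Ico p q, 1 :=
        lintegral_mono fun _ => tsub_le_self
    _ = _ := by simp

lemma tailIntegral_antitone (φ : ℝ → ENNReal) : Antitone (tailIntegral φ) := fun _ _ h =>
  lintegral_mono_set (Set.Ici_subset_Ici.2 h)

/-! ### Laplace functional of the ratios of squared distances -/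

/-- Sum over the points other than the nearest one, through the ratios of squared distances. -/
noncomputable def ratioSum {Ω : Type*} (φ : ℝ → ENNReal) (X : ℕ → Ω → Plane) (ω : Ω) :
    ENNReal :=
  ∑' i, φ (‖X (i + 1) ω‖ ^ 2 / ‖X 0 ω‖ ^ 2)

lemma measurable_ratioSum {Ω : Type*} [MeasurableSpace Ω] {X : ℕ → Ω → Plane}
    (hX : ∀ i, Measurable (X i)) {φ : ℝ → ENNReal} (hφ : Measurable φ) :
    Measurable (ratioSum φ X) :=
  Measurable.tsum fun i =>
    hφ.comp (((hX (i + 1)).norm.pow_const 2).div ((hX 0).norm.pow_const 2))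

lemma measurableSet_sq_norm_Ico {Ω : Type*} [MeasurableSpace Ω] {X : ℕ → Ω → Plane}
    (hX : ∀ i, Measurable (X i)) (a b : ℝ) :
    MeasurableSet {ω | ‖X 0 ω‖ ^ 2 ∈ Set.Ico a b} :=
  ((hX 0).norm.pow_const 2) measurableSet_Ico

lemma tsum_cellTest_eq_top {Ω : Type*} {X : ℕ → Ω → Plane} {φ : ℝ → ENNReal} {a b c : ℝ}
    {s : ENNReal} {ω : Ω}
    (h : ‖X 0 ω‖ ^ 2 < a) : ∑' i, cellTest φ a b c s (‖X i ω‖ ^ 2) = ⊤ :=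
  top_unique (le_trans (by simp [cellTest, h]) (ENNReal.le_tsum 0))

namespace IsHomogeneousPPP

variable {Ω : Type*} [MeasurableSpace Ω] {μ : Measure Ω} [IsProbabilityMeasure μ] {lam : ℝ}
  {X : ℕ → Ω → Plane}

/-- The functionals with void radius `a` and `b` agree when `‖X 0‖ ^ 2 ≥ b` and both vanish when it
is below `a`, so their difference lives on the cell. There, dividing by `a` instead of `‖X 0‖ ^ 2`
and dropping the points below `b` can only decrease the sum, as `φ` is antitone. -/
lemma setLIntegral_cell_le (h : IsHomogeneousPPP μ lam X) (hlam : 0 ≤ lam)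
    (hnear : ∀ᵐ ω ∂μ, ∀ i, ‖X 0 ω‖ ≤ ‖X i ω‖) {φ : ℝ → ENNReal} (hφ : Measurable φ)
    (hanti : AntitoneOn φ (Set.Ioi 0)) {a b : ℝ} (ha : 0 < a) (hab : a ≤ b)
    (hD : tailIntegral φ (b / a) ≠ ⊤) :
    ∫⁻ ω in {ω | ‖X 0 ω‖ ^ 2 ∈ Set.Ico a b}, expNeg (ratioSum φ X ω) ∂μ ≤
      ENNReal.ofReal (Real.exp (-(lam * Real.pi * (a * (tailIntegral φ (b / a)).toReal))) *
        (Real.exp (-(lam * Real.pi * a)) - Real.exp (-(lam * Real.pi * b)))) := by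
  have hm := measurableSet_sq_norm_Ico h.measurable a b
  have h1 := h.laplace_cellTest hlam hφ ha hab ha 0 hD
  have h2 := h.laplace_cellTest hlam hφ (ha.trans_le hab) le_rfl ha 0 hD
  have key : ∀ᵐ ω ∂μ, {ω | ‖X 0 ω‖ ^ 2 ∈ Set.Ico a b}.indicator
      (fun ω => expNeg (ratioSum φ X ω)) ω +
        expNeg (∑' i, cellTest φ b b a 0 (‖X i ω‖ ^ 2)) ≤
          expNeg (∑' i, cellTest φ a b a 0 (‖X i ω‖ ^ 2)) := by
    filter_upwards [hnear] with ω hω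
    have hω2 : ∀ i, ‖X 0 ω‖ ^ 2 ≤ ‖X i ω‖ ^ 2 := fun i =>
      pow_le_pow_left₀ (norm_nonneg _) (hω i) 2
    rcases lt_or_ge (‖X 0 ω‖ ^ 2) a with hlt | hge
    · rw [Set.indicator_of_notMem (fun hh => hlt.not_ge hh.1),
        tsum_cellTest_eq_top (hlt.trans_le hab), expNeg_top, add_zero]
      exact zero_le
    · rcases lt_or_ge (‖X 0 ω‖ ^ 2) b with hlt' | hge'
      · rw [Set.indicator_of_mem
          (show ω ∈ {ω | ‖X 0 ω‖ ^ 2 ∈ Set.Ico a b} from ⟨hge, hlt'⟩),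
          tsum_cellTest_eq_top hlt', expNeg_top, add_zero]
        refine expNeg_antitone ?_
        rw [tsum_eq_zero_add' ENNReal.summable]
        have h0 : cellTest φ a b a 0 (‖X 0 ω‖ ^ 2) = 0 := by
          simp [cellTest, hge.not_gt, hlt']
        rw [h0, zero_add]
        refine ENNReal.tsum_le_tsum fun i => ?_
        have hai := (hge.trans (hω2 (i + 1)))
        unfold cellTest
        rw [if_neg hai.not_gt]
        split_ifs with hb
        · exact zero_le
        · refine hanti ?_ ?_ ?_
          · exact div_pos (ha.trans_le hai) (ha.trans_le hge)
          · exact div_pos (ha.trans_le hai) ha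
          · exact div_le_div_of_nonneg_left (by positivity) ha hge
      · rw [Set.indicator_of_notMem (fun hh => hge'.not_gt hh.2), zero_add]
        refine (congrArg expNeg (tsum_congr fun i => ?_)).le
        have hbi := hge'.trans (hω2 i)
        simp [cellTest, hbi.not_gt, (hab.trans hbi).not_gt]
  have hint := lintegral_mono_ae key
  have hmr : Measurable fun ω => expNeg (ratioSum φ X ω) :=
    measurable_expNeg.comp (measurable_ratioSum h.measurable hφ)
  rw [lintegral_add_left (hmr.indicator hm), lintegral_indicator hm, h1, h2] at hint
  have h3 := ENNReal.le_sub_of_add_le_right ENNReal.ofReal_ne_top hint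
  refine h3.trans_eq ?_
  rw [← ENNReal.ofReal_sub _ (Real.exp_pos _).le,
    mul_sub (Real.exp (-(lam * Real.pi * (a * _)))), ← Real.exp_add, ← Real.exp_add]
  congr 3
  · simp only [expNeg_zero, ENNReal.toReal_one]
    ring
  · simp only [expNeg_zero, ENNReal.toReal_one]
    ring

/-- Mirror image of the upper bound: now division is by `b`, and each point of the annulus is
charged `φ 1`, the largest value of `φ` on ratios at least one. The nearest point is charged too,
hence a factor `expNeg (φ 1)` that must cancel at the end. -/
lemma le_setLIntegral_cell (h : IsHomogeneousPPP μ lam X) (hlam : 0 ≤ lam)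
    (hnear : ∀ᵐ ω ∂μ, ∀ i, ‖X 0 ω‖ ≤ ‖X i ω‖) {φ : ℝ → ENNReal} (hφ : Measurable φ)
    (hanti : AntitoneOn φ (Set.Ioi 0)) (hφ1 : φ 1 ≠ ⊤) {a b : ℝ} (ha : 0 < a) (hab : a ≤ b)
    (hD : tailIntegral φ 1 ≠ ⊤) :
    ENNReal.ofReal (lam * Real.pi * (b - a) *
        Real.exp (-(lam * Real.pi * (b * (1 + (tailIntegral φ 1).toReal))))) ≤
      ∫⁻ ω in {ω | ‖X 0 ω‖ ^ 2 ∈ Set.Ico a b}, expNeg (ratioSum φ X ω) ∂μ := by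
  have hb := ha.trans_le hab
  have hm := measurableSet_sq_norm_Ico h.measurable a b
  have hbb : b / b = 1 := div_self hb.ne'
  have h1 := h.laplace_cellTest hlam hφ ha hab hb (φ 1) (by rwa [hbb])
  have h2 := h.laplace_cellTest hlam hφ hb le_rfl hb (φ 1) (by rwa [hbb])
  have key : ∀ᵐ ω ∂μ, expNeg (∑' i, cellTest φ a b b (φ 1) (‖X i ω‖ ^ 2)) ≤
      {ω | ‖X 0 ω‖ ^ 2 ∈ Set.Ico a b}.indicator
        (fun ω => expNeg (φ 1) * expNeg (ratioSum φ X ω)) ω +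
          expNeg (∑' i, cellTest φ b b b (φ 1) (‖X i ω‖ ^ 2)) := by
    filter_upwards [hnear] with ω hω
    have hω2 : ∀ i, ‖X 0 ω‖ ^ 2 ≤ ‖X i ω‖ ^ 2 := fun i =>
      pow_le_pow_left₀ (norm_nonneg _) (hω i) 2
    rcases lt_or_ge (‖X 0 ω‖ ^ 2) a with hlt | hge
    · rw [tsum_cellTest_eq_top hlt, expNeg_top]
      exact zero_le
    · rcases lt_or_ge (‖X 0 ω‖ ^ 2) b with hlt' | hge'
      · rw [Set.indicator_of_mem
          (show ω ∈ {ω | ‖X 0 ω‖ ^ 2 ∈ Set.Ico a b} from ⟨hge, hlt'⟩),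
          tsum_cellTest_eq_top hlt', expNeg_top, add_zero,
          ← expNeg_add]
        refine expNeg_antitone ?_
        rw [tsum_eq_zero_add' ENNReal.summable]
        have h0 : cellTest φ a b b (φ 1) (‖X 0 ω‖ ^ 2) = φ 1 := by
          simp [cellTest, hge.not_gt, hlt']
        rw [h0]
        refine add_le_add_right (ENNReal.tsum_le_tsum fun i => ?_) _
        have hai := (hge.trans (hω2 (i + 1)))
        have hpos := ha.trans_le hge
        unfold cellTest
        rw [if_neg hai.not_gt]
        split_ifs with hb'
        · refine hanti (Set.mem_Ioi.2 one_pos) ?_ ?_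
          · exact div_pos (ha.trans_le hai) hpos
          · rw [le_div_iff₀ hpos, one_mul]
            exact hω2 _
        · refine hanti ?_ ?_ ?_
          · exact div_pos (ha.trans_le hai) hb
          · exact div_pos (ha.trans_le hai) hpos
          · exact div_le_div_of_nonneg_left (by positivity) hpos hlt'.le
      · rw [Set.indicator_of_notMem (fun hh => hge'.not_gt hh.2), zero_add]
        refine (congrArg expNeg (tsum_congr fun i => ?_)).le
        have hbi := hge'.trans (hω2 i)
        simp [cellTest, hbi.not_gt, (hab.trans hbi).not_gt]
  have hint := lintegral_mono_ae key
  have hmr : Measurable fun ω => expNeg (ratioSum φ X ω) :=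
    measurable_expNeg.comp (measurable_ratioSum h.measurable hφ)
  rw [lintegral_add_left ((hmr.const_mul _).indicator hm), lintegral_indicator hm, h1, h2,
    lintegral_const_mul _ hmr, hbb] at hint
  obtain ⟨x, hx⟩ : ∃ x, x = (expNeg (φ 1)).toReal := ⟨_, rfl⟩
  have hxpos : 0 < x := by
    rw [hx, ← ENNReal.ofReal_toReal hφ1, expNeg_ofReal ENNReal.toReal_nonneg,
      ENNReal.toReal_ofReal (Real.exp_pos _).le]
    exact Real.exp_pos _
  have hxe : expNeg (φ 1) = ENNReal.ofReal x := by rw [hx, ENNReal.ofReal_toReal (expNeg_ne_top _)]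
  rw [← hx, hxe] at hint
  have h3 := tsub_le_iff_right.2 hint
  rw [← ENNReal.ofReal_sub _ (Real.exp_pos _).le] at h3
  set E := ∫⁻ ω in {ω | ‖X 0 ω‖ ^ 2 ∈ Set.Ico a b}, expNeg (ratioSum φ X ω) ∂μ
  set D := (tailIntegral φ 1).toReal
  have h4 : ENNReal.ofReal x * ENNReal.ofReal (lam * Real.pi * (b - a) *
      Real.exp (-(lam * Real.pi * (b * (1 + D))))) ≤ ENNReal.ofReal x * E := by
    rw [← ENNReal.ofReal_mul hxpos.le]
    refine le_trans (ENNReal.ofReal_le_ofReal ?_) h3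
    have e1 : Real.exp (-(lam * Real.pi * (a + (b - a) * (1 - x) + b * D))) =
        Real.exp (-(lam * Real.pi * (b * (1 + D)))) * Real.exp (lam * Real.pi * (b - a) * x) := by
      rw [← Real.exp_add]; ring_nf
    have e2 : Real.exp (-(lam * Real.pi * (b + (b - b) * (1 - x) + b * D))) =
        Real.exp (-(lam * Real.pi * (b * (1 + D)))) := by ring_nf
    rw [e1, e2]
    -- Linearising the exponential brings out the factor `x`, which cancels the charge of the
    -- nearest point.
    have := Real.add_one_le_exp (lam * Real.pi * (b - a) * x)
    nlinarith [mul_le_mul_of_nonneg_left this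
      (Real.exp_pos (-(lam * Real.pi * (b * (1 + D))))).le]
  exact (ENNReal.mul_le_mul_iff_right (by simpa using hxpos) ENNReal.ofReal_ne_top).1 h4

lemma lintegral_eq_tsum_cells (h : IsHomogeneousPPP μ lam X) (hlam : 0 ≤ lam) {q : ℝ}
    (hq : 1 < q) (F : Ω → ENNReal) :
    ∫⁻ ω, F ω ∂μ =
      ∑' k : ℤ, ∫⁻ ω in {ω | ‖X 0 ω‖ ^ 2 ∈ Set.Ico (q ^ k) (q ^ (k + 1))}, F ω ∂μ := by
  rw [← lintegral_iUnion (fun k => measurableSet_sq_norm_Ico h.measurable _ _)]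
  · rw [← setLIntegral_univ]
    refine setLIntegral_congr (eventuallyEq_set.2 ?_)
    filter_upwards [h.ae_sq_norm_zero_pos hlam] with ω hω
    simp only [Set.mem_univ, Set.mem_iUnion, true_iff]
    exact exists_mem_Ico_zpow hω hq
  · intro i j hij
    exact Set.disjoint_left.2 fun ω h1 h2 =>
      Set.disjoint_left.1 (pairwise_disjoint_Ico_zpow_of_one_lt hq hij) h1 h2

/-- For a Poisson point process with nearest point `X 0`, the Laplace functional of the ratios of
squared distances does not depend on the intensity. -/
theorem lintegral_expNeg_ratioSum (h : IsHomogeneousPPP μ lam X) (hlam : 0 < lam)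
    (hnear : ∀ᵐ ω ∂μ, ∀ i, ‖X 0 ω‖ ≤ ‖X i ω‖) {φ : ℝ → ENNReal} (hφ : Measurable φ)
    (hanti : AntitoneOn φ (Set.Ioi 0)) (hφ1 : φ 1 ≠ ⊤) (hD : tailIntegral φ 1 ≠ ⊤) :
    ∫⁻ ω, expNeg (ratioSum φ X ω) ∂μ =
      ENNReal.ofReal (1 / (1 + (tailIntegral φ 1).toReal)) := by
  have hL : 0 < lam * Real.pi := mul_pos hlam Real.pi_pos
  obtain ⟨D, hDdef⟩ : ∃ D, D = (tailIntegral φ 1).toReal := ⟨_, rfl⟩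
  have hD0 : 0 ≤ D := hDdef ▸ ENNReal.toReal_nonneg
  rw [← hDdef]
  apply le_antisymm
  -- On cells of ratio `q`, the upper bound is at most `1 / (1 + κ)` times the mass of an
  -- exponential law of rate `lam π (1 + κ)`. Summing the cells leaves `1 / (1 + κ)`, free of `lam`.
  · have hle : ∀ q : ℝ, 1 < q → ∫⁻ ω, expNeg (ratioSum φ X ω) ∂μ ≤
        ENNReal.ofReal (1 / (1 + (D - (q - 1)) / q)) := by
      intro q hq
      have hq0 : 0 < q := one_pos.trans hq
      have hDq : tailIntegral φ q ≠ ⊤ := ne_top_of_le_ne_top hD (tailIntegral_antitone φ hq.le)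
      obtain ⟨κ, hκ⟩ : ∃ κ, κ = (tailIntegral φ q).toReal / q := ⟨_, rfl⟩
      have hκ0 : 0 ≤ κ := hκ ▸ div_nonneg ENNReal.toReal_nonneg hq0.le
      -- The integrand of the tail integral is at most one, so moving its endpoint from `1` to `q`
      -- loses at most `q - 1`.
      have hκD : (D - (q - 1)) / q ≤ κ := by
        rw [hκ]
        refine div_le_div_of_nonneg_right ?_ hq0.le
        have := ENNReal.toReal_mono (ENNReal.add_ne_top.2 ⟨ENNReal.ofReal_ne_top, hDq⟩)
          (tailIntegral_le_add (φ := φ) hq.le)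
        rw [ENNReal.toReal_add ENNReal.ofReal_ne_top hDq,
          ENNReal.toReal_ofReal (by linarith)] at this
        linarith
      have hpos : 0 < 1 + (D - (q - 1)) / q := by
        rw [show 1 + (D - (q - 1)) / q = (D + 1) / q by field_simp; ring]
        positivity
      have hcell : ∀ k : ℤ, ∫⁻ ω in {ω | ‖X 0 ω‖ ^ 2 ∈ Set.Ico (q ^ k) (q ^ (k + 1))},
          expNeg (ratioSum φ X ω) ∂μ ≤ ENNReal.ofReal (1 / (1 + κ)) *
            expMeasure (lam * Real.pi * (1 + κ)) (Set.Ico (q ^ k) (q ^ (k + 1))) := by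
        intro k
        have hk := zpow_pos hq0 k
        have hkk : q ^ (k + 1) = q ^ k * q := zpow_add_one₀ hq0.ne' k
        have hle : q ^ k ≤ q ^ (k + 1) := by rw [hkk]; nlinarith
        have hdiv : q ^ (k + 1) / q ^ k = q := by rw [hkk]; field_simp
        refine (h.setLIntegral_cell_le hlam.le hnear hφ hanti hk hle (by rwa [hdiv])).trans ?_
        rw [expMeasure_Ico (by positivity) hk.le hle, ← ENNReal.ofReal_mul (by positivity), hdiv]
        refine ENNReal.ofReal_le_ofReal ?_
        convert one_add_mul_exp_sub_le hκ0 (lam * Real.pi * q ^ k)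
          (lam * Real.pi * q ^ (k + 1)) using 3
        · rw [hkk, hκ]; field_simp
        · ring_nf
        · ring_nf
      rw [h.lintegral_eq_tsum_cells hlam.le hq]
      refine (ENNReal.tsum_le_tsum hcell).trans ?_
      rw [ENNReal.tsum_mul_left, tsum_measure_Ico_zpow _ hq, expMeasure_Ioi_zero (by positivity),
        mul_one]
      exact ENNReal.ofReal_le_ofReal (one_div_le_one_div_of_le hpos (by linarith))
    have ht : Tendsto (fun q : ℝ => ENNReal.ofReal (1 / (1 + (D - (q - 1)) / q))) (𝓝[>] 1)
        (𝓝 (ENNReal.ofReal (1 / (1 + D)))) := by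
      refine (ENNReal.continuous_ofReal.tendsto _).comp ?_
      have : ContinuousAt (fun q : ℝ => 1 / (1 + (D - (q - 1)) / q)) 1 := by
        refine ContinuousAt.div (by fun_prop) ?_ (by simp; positivity)
        exact continuousAt_const.add (ContinuousAt.div (by fun_prop) continuousAt_id one_ne_zero)
      have h2 := this.tendsto.mono_left (nhdsWithin_le_nhds (s := Set.Ioi 1))
      simpa using h2
    exact ge_of_tendsto ht (eventually_nhdsWithin_of_forall hle)
  -- Writing the right endpoint of a cell as `q` times the left one gives the rate `lam π q (1 +
  -- D)`. The mass of that exponential law on a cell is at most its density at the left end times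
  -- the length.
  · have hle : ∀ q : ℝ, 1 < q → ENNReal.ofReal (1 / (q * (1 + D))) ≤
        ∫⁻ ω, expNeg (ratioSum φ X ω) ∂μ := by
      intro q hq
      have hq0 : 0 < q := one_pos.trans hq
      have hcell : ∀ k : ℤ, ENNReal.ofReal (1 / (q * (1 + D))) *
          expMeasure (lam * Real.pi * (q * (1 + D))) (Set.Ico (q ^ k) (q ^ (k + 1))) ≤
            ∫⁻ ω in {ω | ‖X 0 ω‖ ^ 2 ∈ Set.Ico (q ^ k) (q ^ (k + 1))},
              expNeg (ratioSum φ X ω) ∂μ := by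
        intro k
        have hk := zpow_pos hq0 k
        have hkk : q ^ (k + 1) = q ^ k * q := zpow_add_one₀ hq0.ne' k
        have hle : q ^ k ≤ q ^ (k + 1) := by rw [hkk]; nlinarith
        refine le_trans ?_ (h.le_setLIntegral_cell hlam.le hnear hφ hanti hφ1 hk hle hD)
        rw [expMeasure_Ico (by positivity) hk.le hle, ← ENNReal.ofReal_mul (by positivity),
          ← hDdef]
        refine ENNReal.ofReal_le_ofReal ?_
        rw [one_div, ← div_eq_inv_mul, div_le_iff₀ (by positivity)]
        set u := lam * Real.pi * (q * (1 + D)) * q ^ k with hu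
        set v := lam * Real.pi * (q * (1 + D)) * q ^ (k + 1) with hv
        have e0 : lam * Real.pi * (q ^ (k + 1) * (1 + D)) = u := by rw [hu, hkk]; ring
        have e1 : Real.exp (-v) = Real.exp (-u) * Real.exp (u - v) := by
          rw [← Real.exp_add]; ring_nf
        have e2 : v - u = lam * Real.pi * (q ^ (k + 1) - q ^ k) * (q * (1 + D)) := by
          rw [hu, hv]; ring
        rw [e0, e1]
        have := Real.add_one_le_exp (u - v)
        nlinarith [mul_le_mul_of_nonneg_left this (Real.exp_pos (-u)).le]
      rw [h.lintegral_eq_tsum_cells hlam.le hq]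
      refine le_trans ?_ (ENNReal.tsum_le_tsum hcell)
      rw [ENNReal.tsum_mul_left, tsum_measure_Ico_zpow _ hq, expMeasure_Ioi_zero (by positivity),
        mul_one]
    have ht : Tendsto (fun q : ℝ => ENNReal.ofReal (1 / (q * (1 + D)))) (𝓝[>] 1)
        (𝓝 (ENNReal.ofReal (1 / (1 + D)))) := by
      refine (ENNReal.continuous_ofReal.tendsto _).comp ?_
      have : ContinuousAt (fun q : ℝ => 1 / (q * (1 + D))) 1 :=
        ContinuousAt.div (by fun_prop) (by fun_prop) (by simp; positivity)
      have h2 := this.tendsto.mono_left (nhdsWithin_le_nhds (s := Set.Ioi 1))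
      simpa using h2
    exact le_of_tendsto ht (eventually_nhdsWithin_of_forall hle)

end IsHomogeneousPPP

/-! ### Averaging over the channel gains -/

lemma expMeasure_lt_ofReal {r : ℝ} (hr : 0 < r) (y : ENNReal) :
    expMeasure r {x | y < ENNReal.ofReal x} = expNeg (ENNReal.ofReal r * y) := by
  have := isProbabilityMeasure_expMeasure hr
  induction y with
  | top =>
    rw [ENNReal.mul_top (by simpa using hr), expNeg_top]
    simp
  | coe a =>
    have : {x : ℝ | (a : ENNReal) < ENNReal.ofReal x} = (Set.Iic (a : ℝ))ᶜ := by
      ext x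
      simp [ENNReal.lt_ofReal_iff_toReal_lt]
    rw [this, prob_compl_eq_one_sub measurableSet_Iic, ← ofReal_cdf, cdf_expMeasure_eq hr,
      if_pos a.coe_nonneg, ← ENNReal.ofReal_coe_nnreal, ← ENNReal.ofReal_mul hr.le,
      expNeg_ofReal (by positivity), ← ENNReal.ofReal_one,
      ← ENNReal.ofReal_sub _ (by simp; positivity)]
    congr 1
    ring

/-- Tilting the density of rate `r` by `exp (-c x)` gives `r / (r + c)` times the density of rate `r
+ c`. The logarithmic form lets products over stations become sums inside `expNeg`. -/
lemma lintegral_expNeg_expMeasure {r c : ℝ} (hr : 0 < r) (hc : 0 ≤ c) :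
    ∫⁻ x, expNeg (ENNReal.ofReal (c * x)) ∂(expMeasure r) =
      expNeg (ENNReal.ofReal (Real.log (1 + c / r))) := by
  have hrc : 0 < r + c := by positivity
  have hpdf : Measurable (exponentialPDF r) :=
    (measurable_exponentialPDFReal r).ennreal_ofReal
  have hpt : ∀ x, exponentialPDF r x * expNeg (ENNReal.ofReal (c * x)) =
      ENNReal.ofReal (r / (r + c)) * exponentialPDF (r + c) x := by
    intro x
    rcases lt_or_ge x 0 with hx | hx
    · rw [exponentialPDF_of_neg hx, exponentialPDF_of_neg hx, zero_mul, mul_zero]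
    · rw [exponentialPDF_of_nonneg hx, exponentialPDF_of_nonneg hx, expNeg_ofReal (by positivity),
        ← ENNReal.ofReal_mul (by positivity), ← ENNReal.ofReal_mul (by positivity)]
      congr 1
      rw [mul_assoc, ← Real.exp_add, ← mul_assoc, div_mul_cancel₀ _ hrc.ne']
      ring_nf
  have h1 : expMeasure r = volume.withDensity (exponentialPDF r) := rfl
  have hm : Measurable fun x : ℝ => expNeg (ENNReal.ofReal (c * x)) :=
    measurable_expNeg.comp (by fun_prop)
  rw [h1, lintegral_withDensity_eq_lintegral_mul _ hpdf hm]
  simp only [Pi.mul_apply, hpt]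
  rw [lintegral_const_mul' _ _ ENNReal.ofReal_ne_top, lintegral_exponentialPDF_eq_one hrc, mul_one,
    expNeg_ofReal (Real.log_nonneg (by linarith [div_nonneg hc hr.le])), ← Real.log_inv,
    Real.exp_log (by positivity)]
  congr 1
  field_simp

/-- The exceedance probability of an exponential gain over an independent random level. -/
lemma measure_lt_ofReal_of_indepFun {Ω : Type*} [MeasurableSpace Ω] {μ : Measure Ω}
    [IsProbabilityMeasure μ] {I : Ω → ENNReal} {g : Ω → ℝ} (hI : Measurable I) (hg : Measurable g)
    (hind : IndepFun I g μ) {r : ℝ} (hr : 0 < r) (hlaw : μ.map g = expMeasure r) :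
    μ {ω | I ω < ENNReal.ofReal (g ω)} = ∫⁻ ω, expNeg (ENNReal.ofReal r * I ω) ∂μ := by
  have hA : MeasurableSet {p : ENNReal × ℝ | p.1 < ENNReal.ofReal p.2} :=
    measurableSet_lt measurable_fst (by fun_prop)
  have hprob : IsProbabilityMeasure (μ.map g) := Measure.isProbabilityMeasure_map hg.aemeasurable
  have h1 : μ {ω | I ω < ENNReal.ofReal (g ω)} =
      (μ.map fun ω => (I ω, g ω)) {p : ENNReal × ℝ | p.1 < ENNReal.ofReal p.2} := by
    rw [Measure.map_apply (hI.prodMk hg) hA]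
    rfl
  rw [h1, (indepFun_iff_map_prod_eq_prod_map_map hI.aemeasurable hg.aemeasurable).1 hind,
    Measure.prod_apply hA, ← lintegral_map (f := fun y => expNeg (ENNReal.ofReal r * y))
      (measurable_expNeg.comp (by fun_prop)) hI]
  refine lintegral_congr fun y => ?_
  rw [hlaw]
  exact expMeasure_lt_ofReal hr y

lemma indepFun_tsum_succ_zero {Ω : Type*} [MeasurableSpace Ω] {μ : Measure Ω}
    {g : ℕ → Ω → ℝ} (hg : ∀ i, Measurable (g i)) (hind : iIndepFun g μ) {f : ℕ → ℝ → ENNReal}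
    (hf : ∀ i, Measurable (f i)) : IndepFun (fun ω => ∑' i, f i (g (i + 1) ω)) (g 0) μ := by
  have h := indep_iSup_of_disjoint (fun i => (hg i).comap_le) hind.iIndep
    (S := Set.range Nat.succ) (T := {0}) (by simp)
  have hvec : IndepFun (fun ω i => g (i + 1) ω) (g 0) μ := by
    rw [IndepFun_iff_Indep]
    refine indep_of_indep_of_le_right (indep_of_indep_of_le_left h ?_)
      (le_iSup₂_of_le 0 rfl le_rfl)
    refine Measurable.comap_le ((@measurable_pi_iff _ _ _ (_) _ _).2 fun i => ?_)
    exact Measurable.mono (comap_measurable (g (i + 1)))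
      (le_iSup₂_of_le (i + 1) ⟨i, rfl⟩ le_rfl) le_rfl
  exact hvec.comp (φ := fun x : ℕ → ℝ => ∑' i, f i (x i)) (ψ := id)
    (Measurable.tsum fun i => (hf i).comp (measurable_pi_apply i)) measurable_id

lemma lintegral_expNeg_tsum_of_iIndepFun {Ω : Type*} [MeasurableSpace Ω] {μ : Measure Ω}
    [IsProbabilityMeasure μ] {Y : ℕ → Ω → ENNReal} (hY : ∀ i, Measurable (Y i))
    (hind : iIndepFun Y μ) {s : ℕ → ENNReal} (hs : ∀ i, ∫⁻ ω, expNeg (Y i ω) ∂μ = expNeg (s i)) :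
    ∫⁻ ω, expNeg (∑' i, Y i ω) ∂μ = expNeg (∑' i, s i) := by
  have hfin : ∀ n : ℕ, ∫⁻ ω, expNeg (∑ i ∈ Finset.range n, Y i ω) ∂μ =
      expNeg (∑ i ∈ Finset.range n, s i) := by
    intro n
    simp_rw [expNeg_sum, ← hs]
    exact lintegral_prod_eq_prod_lintegral_of_indepFun _ _
      (hind.comp (fun _ => expNeg) fun _ => measurable_expNeg)
      fun i => measurable_expNeg.comp (hY i)
  have h1 : Tendsto (fun n => ∫⁻ ω, expNeg (∑ i ∈ Finset.range n, Y i ω) ∂μ) atTop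
      (𝓝 (∫⁻ ω, expNeg (∑' i, Y i ω) ∂μ)) := by
    refine tendsto_lintegral_of_dominated_convergence (fun _ => 1)
      (fun n => measurable_expNeg.comp (Finset.measurable_sum _ fun i _ => hY i))
      (fun n => Eventually.of_forall fun ω => expNeg_le_one _) (by simp)
      (Eventually.of_forall fun ω => ?_)
    exact (continuous_expNeg.tendsto _).comp (ENNReal.tendsto_nat_tsum _)
  have h2 : Tendsto (fun n => expNeg (∑ i ∈ Finset.range n, s i)) atTop
      (𝓝 (expNeg (∑' i, s i))) :=
    (continuous_expNeg.tendsto _).comp (ENNReal.tendsto_nat_tsum _)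
  exact tendsto_nhds_unique h1 (h2.congr fun n => (hfin n).symm)

/-- This is coverage for frozen positions. The serving rate `1 / (2 Na)` against the interfering
rate `1 / 2` turns `c i` into `c i / Na`, which is where `τ / Na` comes from. -/
lemma measure_tsum_gain_lt {Ω : Type*} [MeasurableSpace Ω] {μ : Measure Ω}
    [IsProbabilityMeasure μ] {g : ℕ → Ω → ℝ} (hg : ∀ i, Measurable (g i)) (hind : iIndepFun g μ)
    {Na : ℕ} (hNa : 0 < Na) (h0 : μ.map (g 0) = expMeasure (1 / (2 * Na)))
    (h1 : ∀ i, μ.map (g (i + 1)) = expMeasure (1 / 2)) {c : ℕ → ℝ} (hc : ∀ i, 0 ≤ c i) :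
    μ {ω | ∑' i, ENNReal.ofReal (c i * g (i + 1) ω) < ENNReal.ofReal (g 0 ω)} =
      expNeg (∑' i, ENNReal.ofReal (Real.log (1 + c i / Na))) := by
  have hNa' : (0 : ℝ) < Na := Nat.cast_pos.2 hNa
  have hr : (0 : ℝ) < 1 / (2 * Na) := by positivity
  have hm : ∀ i, Measurable fun x : ℝ => ENNReal.ofReal (c i * x) := fun i => by fun_prop
  rw [measure_lt_ofReal_of_indepFun
    (I := fun ω => ∑' i, ENNReal.ofReal (c i * g (i + 1) ω))
    (Measurable.tsum fun i => (hm i).comp (hg (i + 1))) (hg 0)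
    (indepFun_tsum_succ_zero hg hind hm) hr h0]
  simp_rw [← ENNReal.tsum_mul_left]
  refine lintegral_expNeg_tsum_of_iIndepFun
    (Y := fun i ω => ENNReal.ofReal (1 / (2 * Na)) * ENNReal.ofReal (c i * g (i + 1) ω))
    (fun i => ((hm i).comp (hg (i + 1))).const_mul _) ?_ fun i => ?_
  · exact (hind.precomp Nat.succ_injective).comp
      (fun i x => ENNReal.ofReal (1 / (2 * Na)) * ENNReal.ofReal (c i * x))
      fun i => (hm i).const_mul _
  · have hci := hc i
    simp_rw [← ENNReal.ofReal_mul hr.le, ← mul_assoc]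
    rw [← lintegral_map (f := fun x => expNeg (ENNReal.ofReal (1 / (2 * Na) * c i * x)))
      (measurable_expNeg.comp (by fun_prop)) (hg (i + 1)), h1,
      lintegral_expNeg_expMeasure (by norm_num) (by positivity)]
    congr 4
    field_simp

namespace MultiSlope

lemma measurable_pathLoss (S : MultiSlope) : Measurable S.pathLoss := by
  refine Finset.measurable_sum _ fun n _ => ?_
  refine Measurable.ite ?_ (by fun_prop) measurable_const
  by_cases hn : n + 1 < S.N
  · simp only [hn, forall_const]
    exact measurableSet_Ico
  · simp only [hn, false_imp_iff, and_true]
    exact measurableSet_Ici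

end MultiSlope

lemma antennaDist_pos {Δh : ℝ} (hΔh : 0 < Δh) (x : Plane) : 0 < antennaDist Δh x :=
  Real.sqrt_pos.2 (by positivity)

lemma measurable_antennaDist (Δh : ℝ) : Measurable (antennaDist Δh) := by
  unfold antennaDist
  fun_prop

/-- Cross-multiplying cancels the power `P` and stays valid when the interference is zero or
infinite. -/
lemma lt_sir_iff {Ω : Type*} {S : MultiSlope} {P Δh τ : ℝ} (hP : 0 < P) (hτ : 0 < τ)
    (X : ℕ → Ω → Plane) (gain : ℕ → Ω → ℝ) (ω : Ω)
    (hS : 0 < S.pathLoss (antennaDist Δh (X 0 ω))) :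
    ENNReal.ofReal τ < sir S P Δh X gain ω ↔
      ∑' i, ENNReal.ofReal (τ * (S.pathLoss (antennaDist Δh (X (i + 1) ω)) /
        S.pathLoss (antennaDist Δh (X 0 ω))) * gain (i + 1) ω) < ENNReal.ofReal (gain 0 ω) := by
  have hτ' : ENNReal.ofReal τ ≠ 0 := by simpa using hτ
  set l := S.pathLoss (antennaDist Δh (X 0 ω))
  have hl : 0 < P * l := mul_pos hP hS
  have hlt : ∀ x y : ENNReal, ENNReal.ofReal (P * l) * x < ENNReal.ofReal (P * l) * y ↔ x < y :=
    fun x y => ENNReal.mul_lt_mul_iff_right (by simpa using hl) ENNReal.ofReal_ne_top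
  have h2 : ENNReal.ofReal (P * gain 0 ω * l) =
      ENNReal.ofReal (P * l) * ENNReal.ofReal (gain 0 ω) := by
    rw [← ENNReal.ofReal_mul hl.le]
    ring_nf
  have h3 : ENNReal.ofReal τ * interference S P Δh X gain ω = ENNReal.ofReal (P * l) *
      ∑' i, ENNReal.ofReal (τ * (S.pathLoss (antennaDist Δh (X (i + 1) ω)) / l) *
        gain (i + 1) ω) := by
    rw [interference, ← ENNReal.tsum_mul_left, ← ENNReal.tsum_mul_left]
    refine tsum_congr fun i => ?_
    rw [← ENNReal.ofReal_mul hl.le, ← ENNReal.ofReal_mul hτ.le]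
    congr 1
    field_simp
  rw [← hlt (∑' i, _), ← h2, ← h3, sir]
  constructor
  · exact ENNReal.mul_lt_of_lt_div
  · intro h
    rw [ENNReal.lt_div_iff_mul_lt]
    · exact h
    · exact Or.inr ENNReal.ofReal_ne_top
    · refine Or.inl fun h0 => ?_
      rw [h0, ENNReal.mul_top hτ'] at h
      exact not_top_lt h

/-- The coverage probability as a Laplace functional of the positions. -/
theorem IsApproxDownlink.measure_coverage {Ω : Type*} [MeasurableSpace Ω] {μ : Measure Ω}
    [IsProbabilityMeasure μ] {lam : ℝ} {Na : ℕ} {X : ℕ → Ω → Plane} {gain : ℕ → Ω → ℝ}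
    (h : IsApproxDownlink μ lam Na X gain) (hNa : 0 < Na) {S : MultiSlope} {P Δh τ : ℝ}
    (hP : 0 < P) (hτ : 0 < τ) (hS : ∀ x : Plane, 0 < S.pathLoss (antennaDist Δh x)) :
    μ {ω | ENNReal.ofReal τ < sir S P Δh X gain ω} =
      ∫⁻ ω, expNeg (∑' i, ENNReal.ofReal (Real.log (1 + τ / Na *
        (S.pathLoss (antennaDist Δh (X (i + 1) ω)) /
          S.pathLoss (antennaDist Δh (X 0 ω)))))) ∂μ := by
  have hae : ∀ i, AEMeasurable (gain i) μ := fun i => by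
    cases i with
    | zero => exact h.gain_serving.aemeasurable
    | succ i => exact (h.gain_interfering i).aemeasurable
  -- A law only makes the gains almost everywhere measurable, so measurable versions take their
  -- place.
  obtain ⟨g, hg⟩ : ∃ g : ℕ → Ω → ℝ, g = fun i => (hae i).mk := ⟨_, rfl⟩
  have hgm : ∀ i, Measurable (g i) := fun i => hg ▸ (hae i).measurable_mk
  have hgeq : ∀ i, gain i =ᵐ[μ] g i := fun i => hg ▸ (hae i).ae_eq_mk
  have hgall : ∀ᵐ ω ∂μ, ∀ i, gain i ω = g i ω := ae_all_iff.2 hgeq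
  have hgind : iIndepFun g μ := (iIndepFun_congr hgeq).1 h.gain_indep
  have hg0 : μ.map (g 0) = expMeasure (1 / (2 * Na)) := by
    rw [← Measure.map_congr (hgeq 0), h.gain_serving.map_eq]
  have hg1 : ∀ i, μ.map (g (i + 1)) = expMeasure (1 / 2) := fun i => by
    rw [← Measure.map_congr (hgeq (i + 1)), (h.gain_interfering i).map_eq]
  have hXm : Measurable fun ω i => X i ω := measurable_pi_lambda _ h.ppp.measurable
  have hgm' : Measurable fun ω i => g i ω := measurable_pi_lambda _ hgm
  have hindep : IndepFun (fun ω i => X i ω) (fun ω i => g i ω) μ :=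
    h.indep.congr (ae_eq_refl _) (by
      filter_upwards [hgall] with ω hω
      exact funext hω)
  obtain ⟨c, hc⟩ : ∃ c : ℕ → (ℕ → Plane) → ℝ, c = fun i x => τ *
    (S.pathLoss (antennaDist Δh (x (i + 1))) / S.pathLoss (antennaDist Δh (x 0))) := ⟨_, rfl⟩
  have hcm : ∀ i, Measurable (c i) := fun i => by
    have hl : ∀ j, Measurable fun x : ℕ → Plane => S.pathLoss (antennaDist Δh (x j)) := fun j =>
      S.measurable_pathLoss.comp ((measurable_antennaDist Δh).comp (measurable_pi_apply j))
    rw [hc]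
    exact ((hl (i + 1)).div (hl 0)).const_mul τ
  have hc0 : ∀ i x, 0 ≤ c i x := fun i x => by
    rw [hc]
    exact mul_nonneg hτ.le (div_nonneg (hS _).le (hS _).le)
  obtain ⟨A, hA⟩ : ∃ A : Set ((ℕ → Plane) × (ℕ → ℝ)), A =
      {p | ∑' i, ENNReal.ofReal (c i p.1 * p.2 (i + 1)) < ENNReal.ofReal (p.2 0)} := ⟨_, rfl⟩
  have hAm : MeasurableSet A := by
    rw [hA]
    refine measurableSet_lt (Measurable.tsum fun i => ?_) (by fun_prop)
    exact (((hcm i).comp measurable_fst).mul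
      ((measurable_pi_apply (i + 1)).comp measurable_snd)).ennreal_ofReal
  have hset : μ {ω | ENNReal.ofReal τ < sir S P Δh X gain ω} =
      (μ.map fun ω => ((fun i => X i ω), fun i => g i ω)) A := by
    rw [Measure.map_apply (hXm.prodMk hgm') hAm]
    refine measure_congr (eventuallyEq_set.2 ?_)
    filter_upwards [hgall] with ω hω
    refine (lt_sir_iff hP hτ X gain ω (hS _)).trans ?_
    simp only [hω, hA, hc]
    rfl
  have : IsProbabilityMeasure (μ.map fun ω i => g i ω) :=
    Measure.isProbabilityMeasure_map hgm'.aemeasurable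
  have hF : Measurable fun x : ℕ → Plane =>
      expNeg (∑' i, ENNReal.ofReal (Real.log (1 + c i x / Na))) :=
    measurable_expNeg.comp (Measurable.tsum fun i =>
      (Real.measurable_log.comp (((hcm i).div_const _).const_add _)).ennreal_ofReal)
  have hfinal : ∫⁻ ω, expNeg (∑' i, ENNReal.ofReal (Real.log (1 + τ / Na *
        (S.pathLoss (antennaDist Δh (X (i + 1) ω)) /
          S.pathLoss (antennaDist Δh (X 0 ω)))))) ∂μ =
      ∫⁻ x, expNeg (∑' i, ENNReal.ofReal (Real.log (1 + c i x / Na)))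
        ∂(μ.map fun ω i => X i ω) := by
    rw [lintegral_map hF hXm]
    simp only [hc, mul_div_right_comm]
  -- Independence makes the joint law a product, so the positions can be frozen and the gains
  -- integrated first.
  rw [hset, (indepFun_iff_map_prod_eq_prod_map_map hXm.aemeasurable hgm'.aemeasurable).1 hindep,
    Measure.prod_apply hAm, hfinal]
  refine lintegral_congr fun x => ?_
  rw [Measure.map_apply hgm' (measurable_prodMk_left hAm), hA]
  exact measure_tsum_gain_lt hgm hgind hNa hg0 hg1 fun i => hc0 i x

/-! ### Comparison of the multi-slope path loss with its last slope -/

namespace MultiSlope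

variable (S : MultiSlope)

lemma R_lt_of_lt {i j : ℕ} (hij : i < j) (hj : j < S.N) : S.R i < S.R j := by
  induction j, hij using Nat.le_induction with
  | base => exact S.R_lt i hj
  | succ j _ ih => exact (ih (by omega)).trans (S.R_lt j hj)

lemma R_le_of_le {i j : ℕ} (hij : i ≤ j) (hj : j < S.N) : S.R i ≤ S.R j := by
  rcases hij.eq_or_lt with rfl | hlt
  · exact le_rfl
  · exact (S.R_lt_of_lt hlt hj).le

lemma α_le_last {n : ℕ} (hn : n < S.N) : S.α n ≤ S.α (S.N - 1) := by
  have : ∀ m, n ≤ m → m < S.N → S.α n ≤ S.α m := by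
    intro m hnm
    induction m, hnm using Nat.le_induction with
    | base => exact fun _ => le_rfl
    | succ m _ ih => exact fun hm => (ih (by omega)).trans (S.α_le m hm)
  exact this _ (by omega) (by omega)

lemma K_succ (n : ℕ) : S.K (n + 1) = S.K n * S.R (n + 1) ^ (S.α (n + 1) - S.α n) := by
  rw [K, Finset.prod_Icc_succ_top (by omega)]
  rfl

lemma K_pos {n : ℕ} (hn : n < S.N) : 0 < S.K n := by
  refine Finset.prod_pos fun i hi => Real.rpow_pos_of_pos ?_ _
  rw [Finset.mem_Icc] at hi
  exact S.R_zero ▸ S.R_lt_of_lt (by omega) (by omega)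

lemma pathLoss_eq {n : ℕ} (hn : n < S.N) {x : ℝ} (h1 : S.R n ≤ x)
    (h2 : n + 1 < S.N → x < S.R (n + 1)) : S.pathLoss x = S.K n * x ^ (-S.α n) := by
  rw [pathLoss, Finset.sum_eq_single n, if_pos ⟨h1, h2⟩]
  · intro m hm hmn
    rw [Finset.mem_range] at hm
    refine if_neg fun ⟨h3, h4⟩ => ?_
    rcases lt_or_gt_of_ne hmn with hlt | hgt
    · exact absurd (h4 (by omega)) (not_lt.2 ((S.R_le_of_le hlt hn).trans h1))
    · exact absurd (h2 (by omega)) (not_lt.2 ((S.R_le_of_le hgt hm).trans h3))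
  · exact fun h => absurd (Finset.mem_range.2 hn) h

lemma exists_slope {x : ℝ} (hx : 0 ≤ x) :
    ∃ n < S.N, S.R n ≤ x ∧ (n + 1 < S.N → x < S.R (n + 1)) := by
  classical
  have hN := S.N_pos
  refine ⟨Nat.findGreatest (fun n => S.R n ≤ x) (S.N - 1), ?_, ?_, fun h => ?_⟩
  · have := Nat.findGreatest_le (P := fun n => S.R n ≤ x) (S.N - 1)
    omega
  · exact Nat.findGreatest_spec (P := fun n => S.R n ≤ x) (Nat.zero_le _) (S.R_zero.le.trans hx)
  · exact not_le.1 (Nat.findGreatest_is_greatest (P := fun n => S.R n ≤ x) (Nat.lt_succ_self _)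
      (by omega))

lemma pathLoss_pos {x : ℝ} (hx : 0 < x) : 0 < S.pathLoss x := by
  obtain ⟨n, hn, h1, h2⟩ := S.exists_slope hx.le
  rw [S.pathLoss_eq hn h1 h2]
  exact mul_pos (S.K_pos hn) (Real.rpow_pos_of_pos hx _)

lemma pathLoss_of_R_last_le {x : ℝ} (h : S.R (S.N - 1) ≤ x) :
    S.pathLoss x = S.K (S.N - 1) * x ^ (-S.α (S.N - 1)) :=
  S.pathLoss_eq (Nat.sub_lt S.N_pos one_pos) h fun h' => by omega

/-- On one slope, path loss times `x ^ β` is a nonnegative power of `x`. Passing from slope `n` to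
slope `m` goes through the corners one at a time. -/
lemma K_mul_rpow_le {β : ℝ} (hβ : ∀ n < S.N, S.α n ≤ β) {n m : ℕ} (hnm : n ≤ m) (hm : m < S.N)
    {x y : ℝ} (hx : 0 < x) (hxy : x ≤ y) (hxn : n + 1 < S.N → x < S.R (n + 1))
    (hy : S.R m ≤ y) : S.K n * x ^ (β - S.α n) ≤ S.K m * y ^ (β - S.α m) := by
  induction m, hnm using Nat.le_induction generalizing y with
  | base =>
    exact mul_le_mul_of_nonneg_left (Real.rpow_le_rpow hx.le hxy (sub_nonneg.2 (hβ n hm)))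
      (S.K_pos hm).le
  | succ m hnm ih =>
    have hxR : x ≤ S.R (m + 1) := (hxn (by omega)).le.trans (S.R_le_of_le (by omega) hm)
    have hR : 0 < S.R (m + 1) := hx.trans_le hxR
    refine (ih (by omega) hxR (S.R_lt m hm).le).trans ?_
    -- The constants `K` are chosen so that adjacent slopes agree at their common corner.
    calc S.K m * S.R (m + 1) ^ (β - S.α m)
        = S.K (m + 1) * S.R (m + 1) ^ (β - S.α (m + 1)) := by
          rw [K_succ, mul_assoc, ← Real.rpow_add hR]
          ring_nf
      _ ≤ _ := mul_le_mul_of_nonneg_left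
          (Real.rpow_le_rpow hR.le hy (sub_nonneg.2 (hβ _ hm))) (S.K_pos hm).le

/-- The path loss decreases at most as fast as with the last exponent. -/
lemma pathLoss_mul_rpow_le {x y : ℝ} (hx : 0 < x) (hxy : x ≤ y) :
    S.pathLoss x * x ^ S.α (S.N - 1) ≤ S.pathLoss y * y ^ S.α (S.N - 1) := by
  obtain ⟨n, hn, hn1, hn2⟩ := S.exists_slope hx.le
  obtain ⟨m, hm, hm1, hm2⟩ := S.exists_slope (hx.le.trans hxy)
  have hy := hx.trans_le hxy
  rw [S.pathLoss_eq hn hn1 hn2, S.pathLoss_eq hm hm1 hm2, mul_assoc, mul_assoc,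
    ← Real.rpow_add hx, ← Real.rpow_add hy, neg_add_eq_sub, neg_add_eq_sub]
  refine S.K_mul_rpow_le (fun _ => S.α_le_last) ?_ hm hx hxy hn2 hm1
  by_contra hlt
  push Not at hlt
  exact absurd (hm2 (by omega)) (not_lt.2 (((S.R_le_of_le hlt hn).trans hn1).trans hxy))

end MultiSlope

lemma antennaDist_rpow (Δh β : ℝ) (x : Plane) :
    antennaDist Δh x ^ β = (‖x‖ ^ 2 + Δh ^ 2) ^ (β / 2) := by
  rw [antennaDist, Real.sqrt_eq_rpow, ← Real.rpow_mul (by positivity)]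
  ring_nf

lemma antennaDist_le {Δh : ℝ} {x y : Plane} (h : ‖x‖ ≤ ‖y‖) :
    antennaDist Δh x ≤ antennaDist Δh y :=
  Real.sqrt_le_sqrt (by gcongr)

namespace MultiSlope

variable (S : MultiSlope) {Δh : ℝ}

/-- Monotonicity of path loss times `x ^ α` handles the slopes; the height is removed because adding
the same amount to numerator and denominator raises a fraction at most one. -/
lemma rpow_neg_le_pathLoss_div (hΔh : 0 < Δh) {x y : Plane} (hx : 0 < ‖x‖ ^ 2) (hxy : ‖x‖ ≤ ‖y‖) :
    (‖y‖ ^ 2 / ‖x‖ ^ 2) ^ (-(S.α (S.N - 1) / 2)) ≤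
      S.pathLoss (antennaDist Δh y) / S.pathLoss (antennaDist Δh x) := by
  have hp : 0 ≤ S.α (S.N - 1) / 2 := by linarith [S.α_last]
  have hdx := antennaDist_pos hΔh x
  have hsq : ‖x‖ ^ 2 ≤ ‖y‖ ^ 2 := pow_le_pow_left₀ (norm_nonneg _) hxy 2
  have hy : 0 < ‖y‖ ^ 2 := hx.trans_le hsq
  have h := S.pathLoss_mul_rpow_le hdx (antennaDist_le (Δh := Δh) hxy)
  rw [antennaDist_rpow, antennaDist_rpow] at h
  have h1 : (‖y‖ ^ 2 / ‖x‖ ^ 2) ^ (-(S.α (S.N - 1) / 2)) ≤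
      ((‖x‖ ^ 2 + Δh ^ 2) / (‖y‖ ^ 2 + Δh ^ 2)) ^ (S.α (S.N - 1) / 2) := by
    rw [Real.rpow_neg (by positivity), ← Real.inv_rpow (by positivity), inv_div]
    refine Real.rpow_le_rpow (by positivity) ?_ hp
    rw [div_le_div_iff₀ hy (by positivity)]
    nlinarith [sq_nonneg Δh]
  refine h1.trans ?_
  rw [Real.div_rpow (by positivity) (by positivity),
    div_le_div_iff₀ (by positivity) (S.pathLoss_pos hdx)]
  linarith

/-- Both stations lie beyond the last corner, so only the last slope occurs and `K` cancels. The
height inflates `‖x‖ ^ 2` by at most the factor `1 + Δh ^ 2 / M`. -/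
lemma pathLoss_div_le (hΔh : 0 < Δh) {x y : Plane} (hxy : ‖x‖ ≤ ‖y‖) {M : ℝ} (hM : 0 < M)
    (hMR : S.R (S.N - 1) ^ 2 ≤ M) (hMx : M ≤ ‖x‖ ^ 2) :
    S.pathLoss (antennaDist Δh y) / S.pathLoss (antennaDist Δh x) ≤
      (1 + Δh ^ 2 / M) ^ (S.α (S.N - 1) / 2) *
        (‖y‖ ^ 2 / ‖x‖ ^ 2) ^ (-(S.α (S.N - 1) / 2)) := by
  have hp : 0 ≤ S.α (S.N - 1) / 2 := by linarith [S.α_last]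
  have hsq : ‖x‖ ^ 2 ≤ ‖y‖ ^ 2 := pow_le_pow_left₀ (norm_nonneg _) hxy 2
  have hx : 0 < ‖x‖ ^ 2 := hM.trans_le hMx
  have hy : 0 < ‖y‖ ^ 2 := hx.trans_le hsq
  have hR : ∀ z : Plane, M ≤ ‖z‖ ^ 2 → S.R (S.N - 1) ≤ antennaDist Δh z := fun z hz =>
    Real.le_sqrt_of_sq_le ((hMR.trans hz).trans (by nlinarith [sq_nonneg Δh]))
  have hK := S.K_pos (Nat.sub_lt S.N_pos one_pos)
  rw [S.pathLoss_of_R_last_le (hR x hMx), S.pathLoss_of_R_last_le (hR y (hMx.trans hsq)),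
    mul_div_mul_left _ _ hK.ne', antennaDist_rpow, antennaDist_rpow, neg_div,
    Real.rpow_neg (by positivity), Real.rpow_neg (by positivity), Real.rpow_neg (by positivity),
    ← Real.inv_rpow (div_nonneg hy.le hx.le), ← Real.mul_rpow (by positivity) (by positivity),
    inv_div, inv_div_inv, ← Real.div_rpow (by positivity) (by positivity)]
  refine Real.rpow_le_rpow (by positivity) ?_ hp
  rw [← mul_div_assoc]
  have h1 : ‖x‖ ^ 2 + Δh ^ 2 ≤ (1 + Δh ^ 2 / M) * ‖x‖ ^ 2 := by
    have : Δh ^ 2 ≤ Δh ^ 2 / M * ‖x‖ ^ 2 := by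
      rw [div_mul_eq_mul_div, le_div_iff₀ hM]
      exact mul_le_mul_of_nonneg_left hMx (sq_nonneg _)
    linarith
  exact div_le_div₀ (by positivity) h1 hy (by nlinarith [sq_nonneg Δh])

end MultiSlope

/-! ### The single-slope tail integral and its hypergeometric form -/

/-- Minus the logarithm of the Laplace transform of a single-slope interference term. -/
noncomputable def slopeTest (p t v : ℝ) : ENNReal := ENNReal.ofReal (Real.log (1 + t * v ^ (-p)))

lemma measurable_slopeTest (p t : ℝ) : Measurable (slopeTest p t) := by
  unfold slopeTest
  fun_prop

lemma antitoneOn_slopeTest {p t : ℝ} (hp : 0 ≤ p) (ht : 0 ≤ t) :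
    AntitoneOn (slopeTest p t) (Set.Ioi 0) := fun x hx y hy hxy => by
  rw [Set.mem_Ioi] at hx hy
  have := Real.rpow_le_rpow_of_nonpos hx hxy (neg_nonpos.2 hp)
  have := Real.rpow_pos_of_pos hy (-p)
  exact ENNReal.ofReal_le_ofReal (Real.log_le_log (by positivity) (by gcongr))

lemma one_sub_expNeg_slopeTest {p t v : ℝ} (ht : 0 ≤ t) (hv : 0 < v) :
    1 - expNeg (slopeTest p t v) = ENNReal.ofReal (t * v ^ (-p) / (1 + t * v ^ (-p))) := by
  have := Real.rpow_pos_of_pos hv (-p)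
  have h1 : 0 ≤ t * v ^ (-p) := by positivity
  rw [slopeTest, expNeg_ofReal (Real.log_nonneg (by linarith)), ← Real.log_inv,
    Real.exp_log (by positivity), ← ENNReal.ofReal_one, ← ENNReal.ofReal_sub _ (by positivity)]
  congr 1
  field_simp
  ring

lemma tailIntegral_slopeTest_one {p t : ℝ} (ht : 0 ≤ t) : tailIntegral (slopeTest p t) 1 =
    ∫⁻ v in Set.Ioi 1, ENNReal.ofReal (t * v ^ (-p) / (1 + t * v ^ (-p))) := by
  rw [tailIntegral, setLIntegral_congr Ioi_ae_eq_Ici.symm]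
  exact setLIntegral_congr_fun measurableSet_Ioi fun v hv =>
    one_sub_expNeg_slopeTest ht (one_pos.trans hv)

lemma tailIntegral_slopeTest_ne_top {p t : ℝ} (hp : 1 < p) (ht : 0 ≤ t) :
    tailIntegral (slopeTest p t) 1 ≠ ⊤ := by
  rw [tailIntegral_slopeTest_one ht]
  have hi : IntegrableOn (fun v : ℝ => t * v ^ (-p)) (Set.Ioi 1) :=
    (integrableOn_Ioi_rpow_of_lt (by linarith) one_pos).const_mul t
  refine ne_top_of_le_ne_top hi.lintegral_lt_top.ne (setLIntegral_mono' measurableSet_Ioi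
    fun v hv => ENNReal.ofReal_le_ofReal ?_)
  have := Real.rpow_pos_of_pos (one_pos.trans (Set.mem_Ioi.1 hv)) (-p)
  exact div_le_self (by positivity) (by linarith [mul_nonneg ht this.le])

/-- For `s ≥ 1`, `s u / (1 + s u) ≤ s u / (1 + u)`. This takes the height factor out of the
integral. -/
lemma tailIntegral_slopeTest_mul_le {p t s : ℝ} (ht : 0 ≤ t) (hs : 1 ≤ s) :
    tailIntegral (slopeTest p (s * t)) 1 ≤ ENNReal.ofReal s * tailIntegral (slopeTest p t) 1 := by
  have hs0 : 0 ≤ s := zero_le_one.trans hs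
  rw [tailIntegral_slopeTest_one (mul_nonneg hs0 ht), tailIntegral_slopeTest_one ht,
    ← lintegral_const_mul' _ _ ENNReal.ofReal_ne_top]
  refine setLIntegral_mono' measurableSet_Ioi fun v hv => ?_
  rw [← ENNReal.ofReal_mul hs0]
  refine ENNReal.ofReal_le_ofReal ?_
  have h1 := Real.rpow_pos_of_pos (one_pos.trans (Set.mem_Ioi.1 hv)) (-p)
  have h2 : 0 ≤ t * v ^ (-p) := by positivity
  rw [mul_assoc s t, ← mul_div_assoc]
  refine div_le_div_of_nonneg_left (by positivity) (by positivity) ?_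
  nlinarith

/-- Here `c - b = 1` in Euler's integral: the factor `(1 - s) ^ 0` disappears and the Gamma quotient
is `b = 1 - 2 / y`. -/
lemma omega1_eq {t y : ℝ} (hy : 2 < y) :
    omega1 t y = (1 - 2 / y) * ∫ s in Set.Ioo (0 : ℝ) 1, s ^ (-(2 / y)) / (1 + t * s) := by
  have hb : 0 < 1 - 2 / y := sub_pos.2 ((div_lt_one (by linarith)).2 hy)
  rw [omega1, gaussHypergeometric, show 2 - 2 / y = (1 - 2 / y) + 1 by ring,
    Real.Gamma_add_one hb.ne', add_sub_cancel_left, Real.Gamma_one, mul_one,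
    mul_div_cancel_right₀ _ (Real.Gamma_pos_of_pos hb).ne',
    intervalIntegral.integral_of_le zero_le_one, integral_Ioc_eq_integral_Ioo]
  congr 1
  refine setIntegral_congr_fun measurableSet_Ioo fun s _ => ?_
  simp only [sub_self, Real.rpow_zero, mul_one, Real.rpow_neg_one]
  rw [div_eq_mul_inv]
  ring_nf

lemma image_rpow_neg_Ioi_one {p : ℝ} (hp : 0 < p) :
    (fun v : ℝ => v ^ (-p)) '' Set.Ioi 1 = Set.Ioo 0 1 := by
  ext s
  constructor
  · rintro ⟨v, hv, rfl⟩
    exact ⟨Real.rpow_pos_of_pos (one_pos.trans hv) _,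
      Real.rpow_lt_one_of_one_lt_of_neg hv (neg_lt_zero.2 hp)⟩
  · rintro ⟨h0, h1⟩
    refine ⟨s ^ (-p)⁻¹, ?_, Real.rpow_inv_rpow h0.le (by linarith)⟩
    exact Real.one_lt_rpow_of_pos_of_lt_one_of_neg h0 h1 (inv_lt_zero.2 (by linarith))

/-- Substitute `s = v ^ (-(y / 2))`, for which `s ^ (-(2 / y)) = v`; the Jacobian and the factor `1
- 2 / y` produce the constant `2 / (y - 2)`. -/
lemma toReal_tailIntegral_slopeTest {t y : ℝ} (ht : 0 ≤ t) (hy : 2 < y) :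
    (tailIntegral (slopeTest (y / 2) t) 1).toReal = delta t y := by
  have hp : 0 < y / 2 := by linarith
  have hsub := integral_image_eq_integral_abs_deriv_smul (s := Set.Ioi (1 : ℝ)) measurableSet_Ioi
    (f := fun v : ℝ => v ^ (-(y / 2))) (f' := fun v => -(y / 2) * v ^ (-(y / 2) - 1))
    (fun v hv => (Real.hasDerivAt_rpow_const (Or.inl (one_pos.trans hv).ne')).hasDerivWithinAt)
    (fun v hv w hw hvw => by
      have hv' := (one_pos.trans (Set.mem_Ioi.1 hv)).le
      have hw' := (one_pos.trans (Set.mem_Ioi.1 hw)).le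
      rw [← Real.rpow_rpow_inv hv' (neg_lt_zero.2 hp).ne,
        ← Real.rpow_rpow_inv hw' (neg_lt_zero.2 hp).ne]
      exact congrArg (· ^ (-(y / 2))⁻¹) hvw)
    (fun s => s ^ (-(2 / y)) / (1 + t * s))
  rw [image_rpow_neg_Ioi_one hp] at hsub
  rw [tailIntegral_slopeTest_one ht, delta, omega1_eq hy, hsub,
    ← integral_eq_lintegral_of_nonneg_ae]
  · rw [← mul_assoc, mul_div_right_comm, ← integral_const_mul]
    refine setIntegral_congr_fun measurableSet_Ioi fun v hv => ?_
    have hv0 : 0 < v := one_pos.trans hv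
    have hvp := Real.rpow_pos_of_pos hv0 (-(y / 2))
    have h1 : (v ^ (-(y / 2))) ^ (-(2 / y)) = v := by
      rw [← Real.rpow_mul hv0.le, show -(y / 2) * -(2 / y) = 1 by field_simp, Real.rpow_one]
    simp only [smul_eq_mul]
    rw [h1, abs_mul, abs_neg, abs_of_pos hp, abs_of_pos (Real.rpow_pos_of_pos hv0 _),
      Real.rpow_sub_one hv0.ne']
    have : y - 2 ≠ 0 := by linarith
    field_simp
  · refine (ae_restrict_iff' measurableSet_Ioi).2 (Eventually.of_forall fun v hv => ?_)
    have := Real.rpow_pos_of_pos (one_pos.trans (Set.mem_Ioi.1 hv)) (-(y / 2))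
    simp only [Pi.zero_apply]
    positivity
  · exact Measurable.aestronglyMeasurable (by fun_prop)

/-! ### Two-sided bounds on the coverage probability -/

namespace IsApproxDownlink

variable {Ω : Type*} [MeasurableSpace Ω] {μ : Measure Ω} [IsProbabilityMeasure μ] {lam : ℝ}
  {Na : ℕ} {X : ℕ → Ω → Plane} {gain : ℕ → Ω → ℝ}

lemma lintegral_slopeTest (h : IsApproxDownlink μ lam Na X gain) (hlam : 0 < lam) {p t : ℝ}
    (hp : 1 < p) (ht : 0 ≤ t) :
    ∫⁻ ω, expNeg (ratioSum (slopeTest p t) X ω) ∂μ =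
      ENNReal.ofReal (1 / (1 + (tailIntegral (slopeTest p t) 1).toReal)) :=
  h.ppp.lintegral_expNeg_ratioSum hlam h.nearest (measurable_slopeTest p t)
    (antitoneOn_slopeTest (by linarith) ht) ENNReal.ofReal_ne_top
    (tailIntegral_slopeTest_ne_top hp ht)

lemma coverageProb_le (h : IsApproxDownlink μ lam Na X gain) (hlam : 0 < lam) (hNa : 0 < Na)
    (S : MultiSlope) {P Δh τ : ℝ} (hP : 0 < P) (hΔh : 0 < Δh) (hτ : 0 < τ) :
    coverageProb μ S P Δh τ X gain ≤ 1 / (1 + delta (τ / Na) (S.α (S.N - 1))) := by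
  have hNa' : (0 : ℝ) < Na := Nat.cast_pos.2 hNa
  have ht : 0 < τ / Na := by positivity
  rw [← toReal_tailIntegral_slopeTest ht.le S.α_last, coverageProb, measureReal_def]
  refine ENNReal.toReal_le_of_le_ofReal (by positivity) ?_
  rw [h.measure_coverage hNa hP hτ fun x => S.pathLoss_pos (antennaDist_pos hΔh x),
    ← h.lintegral_slopeTest hlam (by linarith [S.α_last]) ht.le]
  refine lintegral_mono_ae ?_
  filter_upwards [h.nearest, h.ppp.ae_sq_norm_zero_pos hlam.le] with ω hω hpos
  refine expNeg_antitone (ENNReal.tsum_le_tsum fun i => ENNReal.ofReal_le_ofReal ?_)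
  have := S.rpow_neg_le_pathLoss_div hΔh hpos (hω (i + 1))
  refine Real.log_le_log ?_ (by gcongr)
  positivity

/-- The comparison with one slope, up to the factor `(1 + Δh ^ 2 / M) ^ (α / 2)`, holds when `‖X 0‖
^ 2 ≥ M`; the complementary event costs at most its probability. -/
lemma le_coverageProb (h : IsApproxDownlink μ lam Na X gain) (hlam : 0 < lam) (hNa : 0 < Na)
    (S : MultiSlope) {P Δh τ : ℝ} (hP : 0 < P) (hΔh : 0 < Δh) (hτ : 0 < τ) {M : ℝ} (hM : 0 < M)
    (hMR : S.R (S.N - 1) ^ 2 ≤ M) :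
    1 / (1 + (1 + Δh ^ 2 / M) ^ (S.α (S.N - 1) / 2) * delta (τ / Na) (S.α (S.N - 1))) -
      (1 - Real.exp (-(lam * Real.pi * M))) ≤ coverageProb μ S P Δh τ X gain := by
  have hNa' : (0 : ℝ) < Na := Nat.cast_pos.2 hNa
  have ht : 0 < τ / Na := by positivity
  have hp : 1 < S.α (S.N - 1) / 2 := by linarith [S.α_last]
  obtain ⟨s, hs⟩ : ∃ s, s = (1 + Δh ^ 2 / M) ^ (S.α (S.N - 1) / 2) := ⟨_, rfl⟩
  have hs1 : 1 ≤ s := hs ▸ Real.one_le_rpow (by linarith [div_pos (pow_pos hΔh 2) hM])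
    (by linarith)
  have hst : 0 ≤ s * (τ / Na) := by positivity
  have hexp : 0 ≤ 1 - Real.exp (-(lam * Real.pi * M)) := by
    have : 0 < lam * Real.pi * M := by have := Real.pi_pos; positivity
    linarith [Real.exp_le_one_iff.2 (neg_nonpos.2 this.le)]
  have hmeas : MeasurableSet {ω | ‖X 0 ω‖ ^ 2 < M} :=
    measurableSet_lt ((h.ppp.measurable 0).norm.pow_const 2) measurable_const
  have hmain : ENNReal.ofReal
      (1 / (1 + (tailIntegral (slopeTest (S.α (S.N - 1) / 2) (s * (τ / Na))) 1).toReal)) ≤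
      ENNReal.ofReal (coverageProb μ S P Δh τ X gain) +
        ENNReal.ofReal (1 - Real.exp (-(lam * Real.pi * M))) := by
    rw [← h.lintegral_slopeTest hlam hp hst, coverageProb, ofReal_measureReal,
      h.measure_coverage hNa hP hτ fun x => S.pathLoss_pos (antennaDist_pos hΔh x)]
    refine le_trans ?_ (add_le_add_right (h.ppp.measure_sq_norm_zero_lt hlam.le hM) _)
    rw [← lintegral_indicator_one hmeas, ← lintegral_add_right _
      (measurable_one.indicator hmeas)]
    refine lintegral_mono_ae ?_
    filter_upwards [h.nearest] with ω hω
    rcases lt_or_ge (‖X 0 ω‖ ^ 2) M with hlt | hge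
    · rw [Set.indicator_of_mem (show ω ∈ {ω | ‖X 0 ω‖ ^ 2 < M} from hlt)]
      exact (expNeg_le_one _).trans le_add_self
    · refine le_trans (expNeg_antitone (ENNReal.tsum_le_tsum fun i =>
        ENNReal.ofReal_le_ofReal ?_)) le_self_add
      have h1 := S.pathLoss_div_le hΔh (hω (i + 1)) hM hMR hge
      rw [← hs] at h1
      have h2 : 0 < S.pathLoss (antennaDist Δh (X (i + 1) ω)) /
          S.pathLoss (antennaDist Δh (X 0 ω)) :=
        div_pos (S.pathLoss_pos (antennaDist_pos hΔh _)) (S.pathLoss_pos (antennaDist_pos hΔh _))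
      refine Real.log_le_log (by positivity) ?_
      rw [mul_comm s, mul_assoc]
      gcongr
  have hcov : 0 ≤ coverageProb μ S P Δh τ X gain := measureReal_nonneg
  rw [← ENNReal.ofReal_add hcov hexp, ENNReal.ofReal_le_ofReal_iff (add_nonneg hcov hexp)] at hmain
  have hD : (tailIntegral (slopeTest (S.α (S.N - 1) / 2) (s * (τ / Na))) 1).toReal ≤
      s * delta (τ / Na) (S.α (S.N - 1)) := by
    rw [← toReal_tailIntegral_slopeTest ht.le S.α_last,
      ← ENNReal.toReal_ofReal (zero_le_one.trans hs1), ← ENNReal.toReal_mul,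
      ENNReal.toReal_ofReal (zero_le_one.trans hs1)]
    exact ENNReal.toReal_mono
      (ENNReal.mul_ne_top ENNReal.ofReal_ne_top (tailIntegral_slopeTest_ne_top hp ht.le))
      (tailIntegral_slopeTest_mul_le ht.le hs1)
  have h1 := one_div_le_one_div_of_le (by positivity) (add_le_add_right hD 1)
  rw [← hs]
  linarith

end IsApproxDownlink

/-! ### The limit at zero density and the supremum -/

theorem theorem3 (S : MultiSlope) (P Δh τ : ℝ) (hP : 0 < P) (hΔh : 0 < Δh) (hτ : 0 < τ)
    (Na : ℕ) (hNa : 0 < Na)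
    {Ω : ℝ → Type*} [∀ lam, MeasurableSpace (Ω lam)] (μ : ∀ lam, Measure (Ω lam))
    [∀ lam, IsProbabilityMeasure (μ lam)]
    (X : ∀ lam, ℕ → Ω lam → Plane) (gain : ∀ lam, ℕ → Ω lam → ℝ)
    (hmodel : ∀ lam, 0 < lam → IsApproxDownlink (μ lam) lam Na (X lam) (gain lam)) :
    (∀ ε : ℝ, 0 < ε →
      (∃ lam : ℝ, 0 < lam ∧ ε < coverageProb (μ lam) S P Δh τ (X lam) (gain lam)) →
        2 * (τ / Na) * omega1 (τ / Na) (S.α (S.N - 1)) / (S.α (S.N - 1) - 2) < ε⁻¹ - 1) ∧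
    Tendsto (fun lam => coverageProb (μ lam) S P Δh τ (X lam) (gain lam)) (𝓝[>] 0)
      (𝓝 (1 / (1 + delta (τ / Na) (S.α (S.N - 1))))) ∧
    IsLUB ((fun lam => coverageProb (μ lam) S P Δh τ (X lam) (gain lam)) '' Set.Ioi 0)
      (1 / (1 + delta (τ / Na) (S.α (S.N - 1)))) := by
  have hNa' : (0 : ℝ) < Na := Nat.cast_pos.2 hNa
  have ht : 0 < τ / Na := by positivity
  have hδ : 0 ≤ delta (τ / Na) (S.α (S.N - 1)) := by
    rw [← toReal_tailIntegral_slopeTest ht.le S.α_last]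
    exact ENNReal.toReal_nonneg
  have hle : ∀ lam : ℝ, 0 < lam → coverageProb (μ lam) S P Δh τ (X lam) (gain lam) ≤
      1 / (1 + delta (τ / Na) (S.α (S.N - 1))) := fun lam hlam =>
    (hmodel lam hlam).coverageProb_le hlam hNa S hP hΔh hτ
  have hlim : Tendsto (fun lam => coverageProb (μ lam) S P Δh τ (X lam) (gain lam)) (𝓝[>] 0)
      (𝓝 (1 / (1 + delta (τ / Na) (S.α (S.N - 1))))) := by
    -- This is the lower bound with `M = 1 / √lam`, a choice for which `M → ∞` while `lam * M → 0`,
    -- so both error terms vanish.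
    have hlower : Tendsto (fun lam : ℝ =>
        1 / (1 + (1 + Δh ^ 2 * √lam) ^ (S.α (S.N - 1) / 2) * delta (τ / Na) (S.α (S.N - 1))) -
          (1 - Real.exp (-(Real.pi * √lam)))) (𝓝[>] 0)
        (𝓝 (1 / (1 + delta (τ / Na) (S.α (S.N - 1))))) := by
      have hc : ContinuousAt (fun lam : ℝ =>
          1 / (1 + (1 + Δh ^ 2 * √lam) ^ (S.α (S.N - 1) / 2) * delta (τ / Na) (S.α (S.N - 1))) -
            (1 - Real.exp (-(Real.pi * √lam)))) 0 := by
        refine ContinuousAt.sub (ContinuousAt.div (by fun_prop) ?_ ?_) (by fun_prop)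
        · refine continuousAt_const.add (ContinuousAt.mul ?_ continuousAt_const)
          exact ContinuousAt.rpow_const (by fun_prop) (Or.inl (by simp))
        · simp only [Real.sqrt_zero, mul_zero, add_zero, Real.one_rpow, one_mul]
          positivity
      have h2 := hc.tendsto.mono_left (nhdsWithin_le_nhds (s := Set.Ioi 0))
      simpa using h2
    refine tendsto_of_tendsto_of_tendsto_of_le_of_le' hlower tendsto_const_nhds ?_
      (eventually_nhdsWithin_of_forall hle)
    -- Ensures that `M = 1 / √lam` eventually dominates the squared last corner distance.
    have hsmall : Tendsto (fun lam : ℝ => S.R (S.N - 1) ^ 2 * √lam) (𝓝[>] 0) (𝓝 0) := by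
      have : Continuous fun lam : ℝ => S.R (S.N - 1) ^ 2 * √lam := by fun_prop
      exact (this.tendsto' 0 0 (by simp)).mono_left nhdsWithin_le_nhds
    filter_upwards [hsmall.eventually_le_const one_pos, self_mem_nhdsWithin] with lam hR hlam
    rw [Set.mem_Ioi] at hlam
    have hsq : 0 < √lam := Real.sqrt_pos.2 hlam
    have hb := (hmodel lam hlam).le_coverageProb hlam hNa S hP hΔh hτ (M := (√lam)⁻¹)
      (by positivity) (by rwa [← one_div, le_div_iff₀ hsq])
    have e1 : lam * Real.pi * (√lam)⁻¹ = Real.pi * √lam := by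
      rw [mul_comm lam, mul_assoc, ← div_eq_mul_inv, Real.div_sqrt]
    rwa [div_inv_eq_mul, e1] at hb
  refine ⟨?_, hlim, ?_, ?_⟩
  · rintro ε hε ⟨lam, hlam, hcov⟩
    have h1 := hcov.trans_le (hle lam hlam)
    change delta (τ / Na) (S.α (S.N - 1)) < ε⁻¹ - 1
    have h2 := (lt_one_div hε (by positivity)).1 h1
    rw [one_div] at h2
    linarith
  · rintro _ ⟨lam, hlam, rfl⟩
    exact hle lam hlam
  · intro b hb
    exact le_of_tendsto hlim (eventually_nhdsWithin_of_forall fun lam hlam => hb ⟨lam, hlam, rfl⟩)
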